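/- Let $G$ be an infinite group, $S\subseteq G$ a finite symmetric generating set, $\mathcal M$ the set of probability measures on $S$, and $\mathcal B$ the set of probability vectors $\mu=(\mu_k)_{k\ge1}$ with finite mean $m(\mu)=\sum_{k\ge 1}k\mu_k$ (both with the topology and the Borel $\sigma$-algebra of coordinatewise convergence). Let $Q$ and $\widetilde Q$ be probability measures on $\mathcal M$ and $\mathcal B$. Assume that there are $\gamma>0$ and a set $S'\subseteq S$ such that every element of $G$ is a finite product of elements of $S'$ and $$Q\{p:\ p(s)>\gamma\ \ \forall s\in S'\}=1,$$ and that $m^*:=\sup\{m(\mu):\mu\in\operatorname{supp}\widetilde Q\}\in[1,\infty]$ satisfies $m^*>1$. Let $\Theta$ be the law of an i.i.d. family $(\omega_x,\mu_x)_{x\in G}$ with marginal $Q\times\widetilde Q$. Given $(\omega,\mu)$ and $x\in G$, the branching random walk in random environment (BRWRE) with law $\mathbb P_{\omega,\mu,x}$ starts at time $0$ with one particle at $x$; at each time step every particle, if located at $y$, is replaced by $k$ offspring with probability $(\mu_y)_k$, and each offspring then moves from $y$ to $z$ with probability $p_\omega(y,z)=\omega_y(y^{-1}z)$ if $y^{-1}z\in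 S$ and $0$ otherwise; all branchings and moves are independent. Let $\eta(n)$ be the number of particles at time $n$ and $x_1(n),\dots,x_{\eta(n)}(n)$ their positions. Then exactly one of the following holds: - for $\Theta$-almost all $(\omega,\mu)$ the BRWRE is strongly recurrent: $$\mathbb P_{\omega,\mu,x}\Big(\sum_{n=1}^\infty\sum_{i=1}^{\eta(n)}\mathbf 1\{x_i(n)=x\}=\infty\Big)=1\quad\text{for all }x\in G;$$ - for $\Theta$-almost all $(\omega,\mu)$ the BRWRE is transient: $$\mathbb P_{\omega,\mu,x}\Big(\sum_{n=1}^\infty\sum_{i=1}^{\eta(n)}\mathbf 1\{x_i(n)=x\}=\infty\Big)=0\quad\text{for all }x\in G.$$ -/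

import Mathlib

open MeasureTheory
open scoped ENNReal

namespace BRWRE

noncomputable section

/-! ### Branching Markov chains

Particles carry Ulam-Harris labels: the root is `[]`, and `i :: v` is the `i`-th child
(counted from `0`) of `v`, so that the length of a label is the generation of the particle. -/

/-- The random input of a branching Markov chain on `X`. For a label `u` and a state `x`,
`(Z (u, x)).1` is the number of children of `u` if `u` is at `x`, and `(Z (u, x)).2` is the state
to which `u` moves at its birth if its parent is at `x`. -/
abbrev Noise (X : Type*) : Type _ := List ℕ × X → ℕ × X

/-- The law of the input for transition probabilities `P x` and offspring distributions `μ x`: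
all particles branch and move independently of each other. -/
def noiseLaw {X : Type*} [MeasurableSpace X] (P : X → PMF X) (μ : X → PMF ℕ) :
    Measure (Noise X) :=
  Measure.infinitePi fun i : List ℕ × X => (μ i.2).toMeasure.prod (P i.2).toMeasure

/-- The position of the particle with a given label, when the root is at `xs`. -/
def pos {X : Type*} (Z : Noise X) (xs : X) : List ℕ → X
  | [] => xs
  | i :: v => (Z (i :: v, pos Z xs v)).2

/-- The particle with a given label is born at some time: its parent is born, and its rank is
smaller than the number of children of the parent. -/
def IsBorn {X : Type*} (Z : Noise X) (xs : X) : List ℕ → Prop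
  | [] => True
  | i :: v => IsBorn Z xs v ∧ i < (Z (v, pos Z xs v)).1

/-- The number of particles that are at `y` at time `n`, when one particle starts at `xs`. -/
def numAt {X : Type*} (Z : Noise X) (xs : X) (n : ℕ) (y : X) : ℕ∞ :=
  {u : List ℕ | u.length = n ∧ IsBorn Z xs u ∧ pos Z xs u = y}.encard

/-- The probability that the branching Markov chain `(X, P, μ)` started with one particle at `x`
visits `x` infinitely often: `∑_{n ≥ 1} #{particles at x at time n} = ∞`. -/
def returnProb {X : Type*} [MeasurableSpace X] (P : X → PMF X) (μ : X → PMF ℕ) (x : X) : ℝ≥0∞ :=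
  noiseLaw P μ {Z | ∑' n : ℕ, ((numAt Z x (n + 1) x : ℕ∞) : ℝ≥0∞) = ∞}

/-! ### The environment -/

/-- The probability vectors `(μ_k)_{k ≥ 1}` with finite mean, written as sequences on `ℕ` that
vanish at `0`, with the topology and the measurable structure of coordinatewise evaluation. -/
def offspringLaws : Set (ℕ → ℝ) :=
  {μ | (∀ k, 0 ≤ μ k) ∧ μ 0 = 0 ∧ HasSum μ 1 ∧ Summable fun k : ℕ => (k : ℝ) * μ k}

/-- The mean `m(μ) = ∑ k μ_k`. -/
def mean (μ : offspringLaws) : ℝ := ∑' k : ℕ, (k : ℝ) * μ.1 k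

/-- `m^* = sup {m(μ) : μ ∈ supp Q'}`, possibly infinite. -/
def mStar (Q' : Measure offspringLaws) : ℝ≥0∞ :=
  ⨆ μ ∈ Q'.support, ENNReal.ofReal (mean μ)

/-- An offspring law as a probability distribution on `ℕ`. -/
def offspringPMF (μ : offspringLaws) : PMF ℕ :=
  ⟨fun k => ENNReal.ofReal (μ.1 k), by
    have h := ENNReal.ofReal_tsum_of_nonneg μ.2.1 μ.2.2.2.1.summable
    rw [μ.2.2.2.1.tsum_eq, ENNReal.ofReal_one] at h
    rw [h]
    exact ENNReal.summable.hasSum⟩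

/-- A probability vector on the finite set `S` as a probability distribution. -/
def stepPMF {G : Type*} {S : Finset G} (p : stdSimplex ℝ S) : PMF S :=
  PMF.ofFintype (fun s => ENNReal.ofReal (p.1 s)) (by
    rw [← ENNReal.ofReal_sum_of_nonneg fun s _ => p.2.1 s, p.2.2, ENNReal.ofReal_one])

/-- The transition probabilities `p_ω(x, y) = ω_x(x⁻¹ y)` for `x⁻¹ y ∈ S`, and `0` otherwise. -/
def transition {G : Type*} [Group G] {S : Finset G} (ω : G → stdSimplex ℝ S) (x : G) : PMF G :=
  (stepPMF (ω x)).map fun s : S => x * (s : G)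

/-- The law of the environment `(ω_x, μ_x)_x`: the pairs `(ω_x, μ_x)` are i.i.d. over the sites
`x`, with marginal `Q × Q'`. -/
def envLaw (G : Type*) {S : Finset G} (Q : Measure (stdSimplex ℝ S))
    (Q' : Measure offspringLaws) : Measure (G → stdSimplex ℝ S × offspringLaws) :=
  Measure.infinitePi fun _ : G => Q.prod Q'

/-- For the environment `e = (ω, μ)`, the probability that the branching random walk with
transition kernel `P_ω` and offspring laws `μ`, started at `x`, visits `x` infinitely often. -/
def quenchedReturnProb {G : Type*} [Group G] [MeasurableSpace G] {S : Finset G}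
    (e : G → stdSimplex ℝ S × offspringLaws) (x : G) : ℝ≥0∞ :=
  returnProb (transition fun y => (e y).1) (fun y => offspringPMF (e y).2) x

end

end BRWRE

/-!
For a fixed environment `e`, the probabilities of visits are governed by the operator `spread e`
on functions `G → [0, 1]`: if `φ z` is the probability of an event for the tree of a particle at
`z`, then `spread e φ y` is the probability that a child of a particle at `y` realizes it. This is
the branching property `noiseLaw_compl_exists_child`. The probability `infVisit e x y` of infinitely
many visits to `x` from `y` is obtained from this operator by limits (`quenchedReturnProb_eq`), and
it is a fixed point of it. The rest of the argument is about this operator.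

Freeze the particles that reach `x`, and let `freeze e x θ n y` be the probability that, from `y`,
one of the particles frozen up to time `n` is a success, when a frozen particle is a success with
probability `θ`. The process survives locally at `x` if `spread e (freeze e x θ n) x > θ` for some
`θ` and `n`; this event depends on finitely many sites only.

* Without local survival at `x`, a particle at `x` has at most one descendant, on average, among
  those that return to `x` for the first time. Hence the numbers of first returns form a critical or
  subcritical branching process, and `infVisit e x x = 0` unless this process is degenerate. The
  existence of one branching site excludes the latter, by strict concavity of `spread e`
  (`infVisit_self_eq_zero`).
* Suppose that local survival at a given site has positive probability. The walk along a line of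
  descent meets, in an i.i.d. environment on an infinite group, sites of local survival almost
  surely. In the form of a maximum principle for bounded subharmonic functions this is
  `ae_maxPrinciple`. Its proof lets the walk explore the environment: each time it enters a cell
  `c * B` that is disjoint from the cells tested before, this cell is good with a fixed positive
  probability, independently of the past, and the walk cannot stay in the finite set of sites that
  belong to no such cell. By the maximum principle `infVisit e x` is bounded below by a positive
  constant. The maximum principle for branching sites, where `1 - infVisit e x` is smaller than its
  supremum by a fixed factor, then gives `infVisit e x = 1` (`infVisit_eq_one`).

Since the law of the environment is invariant under translations, one of the two cases holds for
almost all environments.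
-/

namespace BRWRE

open Filter Topology Set ProbabilityTheory

/-! ### The generating function of an offspring law -/

/-- The probability that at least one child is marked, when the number of children has law `μ`
and each child is marked independently with probability `t`. In terms of the generating function
`g` of `μ` this is `1 - g (1 - t)`. -/
noncomputable def fission (μ : offspringLaws) (t : ℝ) : ℝ := ∑' k : ℕ, μ.1 k * (1 - (1 - t) ^ k)

/-- The quotient `fission μ t / t`, written as a series that also makes sense at `t = 0`, where
its value is the mean of `μ`. -/
noncomputable def fissionRatio (μ : offspringLaws) (t : ℝ) : ℝ :=
  ∑' k : ℕ, μ.1 k * ∑ i ∈ Finset.range k, (1 - t) ^ i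

section Scalar

variable (μ : offspringLaws) {s t r : ℝ}

lemma geom_le_card (ht : t ∈ Icc (0 : ℝ) 1) (k : ℕ) :
    ∑ i ∈ Finset.range k, (1 - t) ^ i ≤ k := by
  calc ∑ i ∈ Finset.range k, (1 - t) ^ i ≤ ∑ i ∈ Finset.range k, (1 : ℝ) :=
        Finset.sum_le_sum fun i _ => pow_le_one₀ (by linarith [ht.2]) (by linarith [ht.1])
    _ = k := by simp

lemma geom_nonneg (ht : t ∈ Icc (0 : ℝ) 1) (k : ℕ) :
    0 ≤ ∑ i ∈ Finset.range k, (1 - t) ^ i :=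
  Finset.sum_nonneg fun i _ => pow_nonneg (by linarith [ht.2]) i

lemma geom_anti (hst : s ≤ t) (ht : t ≤ 1) (k : ℕ) :
    ∑ i ∈ Finset.range k, (1 - t) ^ i ≤ ∑ i ∈ Finset.range k, (1 - s) ^ i :=
  Finset.sum_le_sum fun i _ => pow_le_pow_left₀ (by linarith) (by linarith) i

lemma summable_fissionRatio (ht : t ∈ Icc (0 : ℝ) 1) :
    Summable fun k : ℕ => μ.1 k * ∑ i ∈ Finset.range k, (1 - t) ^ i := by
  refine Summable.of_nonneg_of_le (fun k => mul_nonneg (μ.2.1 k) (geom_nonneg ht k)) (fun k => ?_)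
    μ.2.2.2.2
  rw [mul_comm]
  exact mul_le_mul_of_nonneg_right (geom_le_card ht k) (μ.2.1 k)

lemma fission_term (t : ℝ) (k : ℕ) :
    μ.1 k * (1 - (1 - t) ^ k) = t * (μ.1 k * ∑ i ∈ Finset.range k, (1 - t) ^ i) := by
  have := mul_neg_geom_sum (1 - t) k
  rw [← this]; ring

lemma fission_eq (t : ℝ) : fission μ t = t * fissionRatio μ t := by
  simp only [fission, fissionRatio, fission_term, tsum_mul_left]

lemma summable_fission (ht : t ∈ Icc (0 : ℝ) 1) :
    Summable fun k : ℕ => μ.1 k * (1 - (1 - t) ^ k) := by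
  simp only [fission_term]
  exact (summable_fissionRatio μ ht).mul_left t

lemma fissionRatio_zero : fissionRatio μ 0 = mean μ := by
  simp [fissionRatio, mean, mul_comm]

lemma fissionRatio_anti (hs : 0 ≤ s) (hst : s ≤ t) (ht : t ≤ 1) :
    fissionRatio μ t ≤ fissionRatio μ s :=
  Summable.tsum_le_tsum (fun k => mul_le_mul_of_nonneg_left (geom_anti hst ht k) (μ.2.1 k))
    (summable_fissionRatio μ ⟨hs.trans hst, ht⟩) (summable_fissionRatio μ ⟨hs, hst.trans ht⟩)

lemma fissionRatio_strictAnti {k : ℕ} (hk : 2 ≤ k) (hμ : 0 < μ.1 k) (hs : 0 ≤ s) (hst : s < t)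
    (ht : t ≤ 1) : fissionRatio μ t < fissionRatio μ s := by
  refine Summable.tsum_lt_tsum (i := k)
    (fun k => mul_le_mul_of_nonneg_left (geom_anti hst.le ht k) (μ.2.1 k)) ?_
    (summable_fissionRatio μ ⟨hs.trans hst.le, ht⟩) (summable_fissionRatio μ ⟨hs, hst.le.trans ht⟩)
  refine mul_lt_mul_of_pos_left (Finset.sum_lt_sum
    (fun i _ => pow_le_pow_left₀ (by linarith) (by linarith) i) ⟨1, ?_, by simpa using hst⟩) hμ
  simpa using (by omega : 1 < k)

lemma fissionRatio_nonneg (ht : t ∈ Icc (0 : ℝ) 1) : 0 ≤ fissionRatio μ t :=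
  tsum_nonneg fun k => mul_nonneg (μ.2.1 k) (geom_nonneg ht k)

lemma mean_nonneg : 0 ≤ mean μ := tsum_nonneg fun k => mul_nonneg (by positivity) (μ.2.1 k)

lemma fissionRatio_le_mean (ht : t ∈ Icc (0 : ℝ) 1) : fissionRatio μ t ≤ mean μ :=
  fissionRatio_zero μ ▸ fissionRatio_anti μ le_rfl ht.1 ht.2

lemma fission_nonneg (ht : t ∈ Icc (0 : ℝ) 1) : 0 ≤ fission μ t := by
  rw [fission_eq]; exact mul_nonneg ht.1 (fissionRatio_nonneg μ ht)

lemma fission_one : fission μ 1 = 1 := by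
  refine (tsum_congr fun k => ?_).trans μ.2.2.2.1.tsum_eq
  rcases Nat.eq_zero_or_pos k with rfl | hk
  · simp [μ.2.2.1]
  · simp [hk.ne']

lemma fission_zero : fission μ 0 = 0 := by simp [fission_eq]

lemma fissionRatio_one_le (ht : t ∈ Icc (0 : ℝ) 1) : 1 ≤ fissionRatio μ t := by
  have h := fission_one μ
  rw [fission_eq, one_mul] at h
  exact h ▸ fissionRatio_anti μ ht.1 ht.2 le_rfl

lemma le_fission (ht : t ∈ Icc (0 : ℝ) 1) : t ≤ fission μ t := by
  rw [fission_eq]; nlinarith [fissionRatio_one_le μ ht, ht.1]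

lemma fission_le_mean_mul (ht : t ∈ Icc (0 : ℝ) 1) : fission μ t ≤ mean μ * t := by
  rw [fission_eq, mul_comm]; exact mul_le_mul_of_nonneg_right (fissionRatio_le_mean μ ht) ht.1

lemma fission_sub_le (hs : 0 ≤ s) (hst : s ≤ t) (ht : t ≤ 1) :
    fission μ t - fission μ s ≤ mean μ * (t - s) := by
  have hs' : s ∈ Icc (0 : ℝ) 1 := ⟨hs, hst.trans ht⟩
  have ht' : t ∈ Icc (0 : ℝ) 1 := ⟨hs.trans hst, ht⟩
  rw [fission, fission, ← (summable_fission μ ht').tsum_sub (summable_fission μ hs'), mean,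
    ← tsum_mul_right]
  refine Summable.tsum_le_tsum (fun k => ?_)
    ((summable_fission μ ht').sub (summable_fission μ hs')) (μ.2.2.2.2.mul_right _)
  have key : (1 - s) ^ k - (1 - t) ^ k ≤ k * (t - s) := by
    induction k with
    | zero => simp
    | succ k ih =>
      have h1 : (1 - t) ^ k ≤ 1 := pow_le_one₀ (by linarith) (by linarith)
      have h2 : (1 - t) ^ k ≤ (1 - s) ^ k := pow_le_pow_left₀ (by linarith) (by linarith) k
      rw [pow_succ, pow_succ]; push_cast
      have : (1 - s) ^ k * (1 - s) - (1 - t) ^ k * (1 - t)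
          = ((1 - s) ^ k - (1 - t) ^ k) * (1 - s) + (1 - t) ^ k * (t - s) := by ring
      rw [this]
      nlinarith [mul_nonneg (sub_nonneg.2 h2) hs, mul_nonneg (sub_nonneg.2 h1) (sub_nonneg.2 hst)]
  nlinarith [mul_le_mul_of_nonneg_left key (μ.2.1 k)]

lemma fission_strictMono (hs : 0 ≤ s) (hst : s < t) (ht : t ≤ 1) : fission μ s < fission μ t := by
  have hs' : s ∈ Icc (0 : ℝ) 1 := ⟨hs, hst.le.trans ht⟩
  have ht' : t ∈ Icc (0 : ℝ) 1 := ⟨hs.trans hst.le, ht⟩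
  obtain ⟨k, hk⟩ : ∃ k, 0 < μ.1 k := by
    by_contra! h
    have : μ.1 = 0 := funext fun k => le_antisymm (h k) (μ.2.1 k)
    have h1 := μ.2.2.2.1.tsum_eq
    rw [this] at h1
    simp at h1
  have hk0 : k ≠ 0 := fun h => by rw [h, μ.2.2.1] at hk; exact lt_irrefl _ hk
  refine Summable.tsum_lt_tsum (i := k) (fun k => mul_le_mul_of_nonneg_left ?_ (μ.2.1 k))
    (mul_lt_mul_of_pos_left ?_ hk) (summable_fission μ hs') (summable_fission μ ht')
  · have : (1 - t) ^ k ≤ (1 - s) ^ k := pow_le_pow_left₀ (by linarith) (by linarith) k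
    linarith
  · have : (1 - t) ^ k < (1 - s) ^ k := pow_lt_pow_left₀ (by linarith) (by linarith) hk0
    linarith

lemma fission_mono (hs : 0 ≤ s) (hst : s ≤ t) (ht : t ≤ 1) : fission μ s ≤ fission μ t := by
  rcases hst.eq_or_lt with rfl | h
  · exact le_rfl
  · exact (fission_strictMono μ hs h ht).le

lemma fission_mem (ht : t ∈ Icc (0 : ℝ) 1) : fission μ t ∈ Icc (0 : ℝ) 1 :=
  ⟨fission_nonneg μ ht, fission_one μ ▸ fission_mono μ ht.1 ht.2 le_rfl⟩

lemma mul_mem_Icc_one (hr : r ∈ Icc (0 : ℝ) 1) (ht : t ∈ Icc (0 : ℝ) 1) : r * t ∈ Icc (0 : ℝ) 1 :=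
  ⟨mul_nonneg hr.1 ht.1, mul_le_one₀ hr.2 ht.1 ht.2⟩

lemma mul_fission_le (hr : r ∈ Icc (0 : ℝ) 1) (ht : t ∈ Icc (0 : ℝ) 1) :
    r * fission μ t ≤ fission μ (r * t) := by
  rw [fission_eq, fission_eq, ← mul_assoc]
  exact mul_le_mul_of_nonneg_left (fissionRatio_anti μ (mul_mem_Icc_one hr ht).1
    (mul_le_of_le_one_left ht.1 hr.2) ht.2) (mul_mem_Icc_one hr ht).1

lemma mul_fission_lt {k : ℕ} (hk : 2 ≤ k) (hμ : 0 < μ.1 k) (hr0 : 0 < r) (hr1 : r < 1)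
    (ht0 : 0 < t) (ht1 : t ≤ 1) : r * fission μ t < fission μ (r * t) := by
  rw [fission_eq, fission_eq, ← mul_assoc]
  exact mul_lt_mul_of_pos_left (fissionRatio_strictAnti μ hk hμ (by positivity)
    (mul_lt_of_lt_one_left ht0 hr1) ht1) (by positivity)

/-- A quantitative gain of branching over `le_fission`. -/
lemma add_le_fission {k : ℕ} (hk : 2 ≤ k) (ht : t ∈ Icc (0 : ℝ) 1) :
    t + μ.1 k * (t * (1 - t)) ≤ fission μ t := by
  have hterm : ∀ j, μ.1 j * t + (if j = k then μ.1 k * (t * (1 - t)) else 0)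
      ≤ μ.1 j * (1 - (1 - t) ^ j) := by
    intro j
    have h1 : (1 - t) ^ k ≤ (1 - t) ^ 2 :=
      pow_le_pow_of_le_one (by linarith [ht.2]) (by linarith [ht.1]) hk
    split_ifs with hj
    · subst hj
      rw [← mul_add]
      exact mul_le_mul_of_nonneg_left (by nlinarith) (μ.2.1 j)
    · rcases Nat.eq_zero_or_pos j with rfl | hj0
      · simp [μ.2.2.1]
      · have h2 : (1 - t) ^ j ≤ (1 - t) ^ 1 :=
          pow_le_pow_of_le_one (by linarith [ht.2]) (by linarith [ht.1]) hj0
        rw [add_zero]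
        exact mul_le_mul_of_nonneg_left (by linarith) (μ.2.1 j)
  have hs1 : HasSum (fun j => μ.1 j * t) t := by simpa using μ.2.2.2.1.mul_right t
  exact (hs1.add (hasSum_ite_eq k (μ.1 k * (t * (1 - t))))).tsum_eq ▸
    Summable.tsum_le_tsum hterm (hs1.add (hasSum_ite_eq k _)).summable (summable_fission μ ht)

lemma tendsto_fissionRatio {u : ℕ → ℝ} (hu : ∀ n, u n ∈ Icc (0 : ℝ) 1)
    (hlim : Tendsto u atTop (𝓝 0)) :
    Tendsto (fun n => fissionRatio μ (u n)) atTop (𝓝 (mean μ)) := by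
  rw [← fissionRatio_zero]
  refine tendsto_tsum_of_dominated_convergence μ.2.2.2.2 (fun k => ?_)
    (Eventually.of_forall fun n k => ?_)
  · have hc : Continuous fun t : ℝ => μ.1 k * ∑ i ∈ Finset.range k, (1 - t) ^ i := by fun_prop
    exact (hc.tendsto 0).comp hlim
  · rw [Real.norm_of_nonneg (mul_nonneg (μ.2.1 k) (geom_nonneg (hu n) k)), mul_comm]
    exact mul_le_mul_of_nonneg_right (geom_le_card (hu n) k) (μ.2.1 k)

/-- The derivative of `fission μ` at `0` is the mean of `μ`, in sequential form. -/
lemma tendsto_fission_div {u θ : ℕ → ℝ} {τ : ℝ} (hu : ∀ n, u n ∈ Icc (0 : ℝ) 1)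
    (hθ : Tendsto θ atTop (𝓝 0)) (hθ0 : ∀ n, θ n ≠ 0)
    (hlim : Tendsto (fun n => u n / θ n) atTop (𝓝 τ)) :
    Tendsto (fun n => fission μ (u n) / θ n) atTop (𝓝 (mean μ * τ)) := by
  have hu0 : Tendsto u atTop (𝓝 0) := by
    have := hlim.mul hθ
    simp only [mul_zero] at this
    exact this.congr fun n => div_mul_cancel₀ _ (hθ0 n)
  refine ((tendsto_fissionRatio μ hu hu0).mul hlim).congr fun n => ?_
  rw [fission_eq]; ring

lemma tendsto_fission {u : ℕ → ℝ} (hu : ∀ n, u n ∈ Icc (0 : ℝ) 1)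
    (hlim : Tendsto u atTop (𝓝 t)) :
    Tendsto (fun n => fission μ (u n)) atTop (𝓝 (fission μ t)) := by
  have ht : t ∈ Icc (0 : ℝ) 1 := isClosed_Icc.mem_of_tendsto hlim (Eventually.of_forall hu)
  rw [tendsto_iff_norm_sub_tendsto_zero] at hlim ⊢
  refine squeeze_zero (fun _ => norm_nonneg _) (fun n => ?_)
    (by simpa using hlim.const_mul (mean μ))
  simp only [Real.norm_eq_abs]
  rcases le_total t (u n) with h | h
  · rw [abs_of_nonneg (sub_nonneg.2 (fission_mono μ ht.1 h (hu n).2)),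
      abs_of_nonneg (sub_nonneg.2 h)]
    exact fission_sub_le μ ht.1 h (hu n).2
  · rw [abs_sub_comm, abs_sub_comm (u n),
      abs_of_nonneg (sub_nonneg.2 (fission_mono μ (hu n).1 h ht.2)),
      abs_of_nonneg (sub_nonneg.2 h)]
    exact fission_sub_le μ (hu n).1 h ht.2

end Scalar

/-! ### The evolution operator of the branching random walk in a fixed environment -/

/-- An environment: a step distribution and an offspring law at each site. -/
abbrev Env {G : Type*} (S : Finset G) : Type _ := G → stdSimplex ℝ S × offspringLaws

variable {G : Type*} {S : Finset G}

/-- The steps in `S'` have probability larger than `γ` at every site. -/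
def Elliptic (γ : ℝ) (S' : Finset G) (e : Env S) : Prop :=
  ∀ y, ∀ s : S, (s : G) ∈ S' → γ < (e y).1.1 s

lemma step_nonneg (e : Env S) (y : G) (s : S) : 0 ≤ (e y).1.1 s := (e y).1.2.1 s

lemma step_sum (e : Env S) (y : G) : ∑ s : S, (e y).1.1 s = 1 := (e y).1.2.2

lemma smul_mem {φ : G → ℝ} {r : ℝ} (hr : r ∈ Icc (0 : ℝ) 1) (h : φ ∈ Icc (0 : G → ℝ) 1) :
    r • φ ∈ Icc (0 : G → ℝ) 1 :=
  ⟨fun y => mul_nonneg hr.1 (h.1 y), fun y => mul_le_one₀ hr.2 (h.1 y) (h.2 y)⟩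

variable [Group G]

/-- The transition operator of the underlying random walk: `avg e φ y` is the mean of `φ` after
one step from `y`. -/
noncomputable def avg (e : Env S) (φ : G → ℝ) (y : G) : ℝ := ∑ s : S, (e y).1.1 s * φ (y * s)

/-- The evolution operator of the branching random walk on functions with values in `[0, 1]`:
if `φ z` is the probability that a particle at `z` is a success, independently of all others,
then `spread e φ y` is the probability that a particle at `y` has a successful child. -/
noncomputable def spread (e : Env S) (φ : G → ℝ) (y : G) : ℝ := fission (e y).2 (avg e φ y)

section Operators

variable (e : Env S) {φ ψ : G → ℝ} {y : G} {r : ℝ}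

lemma avg_mono (h : φ ≤ ψ) : avg e φ ≤ avg e ψ := fun y =>
  Finset.sum_le_sum fun s _ => mul_le_mul_of_nonneg_left (h _) (step_nonneg e y s)

lemma avg_const (c : ℝ) (y : G) : avg e (fun _ => c) y = c := by
  rw [avg, ← Finset.sum_mul, step_sum, one_mul]

lemma avg_add (φ ψ : G → ℝ) (y : G) : avg e (fun z => φ z + ψ z) y = avg e φ y + avg e ψ y := by
  simp [avg, mul_add, Finset.sum_add_distrib]

lemma avg_sub (φ ψ : G → ℝ) (y : G) : avg e (fun z => φ z - ψ z) y = avg e φ y - avg e ψ y := by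
  simp [avg, mul_sub, Finset.sum_sub_distrib]

lemma avg_smul (r : ℝ) (φ : G → ℝ) (y : G) : avg e (r • φ) y = r * avg e φ y := by
  simp only [avg, Finset.mul_sum, Pi.smul_apply, smul_eq_mul]
  exact Finset.sum_congr rfl fun s _ => by ring

lemma avg_mem (h : φ ∈ Icc (0 : G → ℝ) 1) (y : G) : avg e φ y ∈ Icc (0 : ℝ) 1 := by
  constructor
  · exact (avg_const e 0 y).ge.trans (avg_mono e (φ := fun _ => 0) h.1 y)
  · exact (avg_mono e (ψ := fun _ => 1) h.2 y).trans (avg_const e 1 y).le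

lemma step_mul_le_avg (h : 0 ≤ φ) (y : G) (s : S) : (e y).1.1 s * φ (y * s) ≤ avg e φ y :=
  Finset.single_le_sum (f := fun s : S => (e y).1.1 s * φ (y * s))
    (fun s _ => mul_nonneg (step_nonneg e y s) (h _)) (Finset.mem_univ s)

lemma tendsto_avg {φ : ℕ → G → ℝ} {ψ : G → ℝ} (h : ∀ y, Tendsto (fun n => φ n y) atTop (𝓝 (ψ y)))
    (y : G) : Tendsto (fun n => avg e (φ n) y) atTop (𝓝 (avg e ψ y)) :=
  tendsto_finsetSum _ fun _ _ => (h _).const_mul _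

lemma spread_mem (h : φ ∈ Icc (0 : G → ℝ) 1) : spread e φ ∈ Icc (0 : G → ℝ) 1 :=
  ⟨fun y => (fission_mem _ (avg_mem e h y)).1, fun y => (fission_mem _ (avg_mem e h y)).2⟩

lemma spread_mono (hφ : 0 ≤ φ) (h : φ ≤ ψ) (hψ : ψ ≤ 1) : spread e φ ≤ spread e ψ := fun y =>
  fission_mono _ (avg_mem e ⟨hφ, h.trans hψ⟩ y).1 (avg_mono e h y)
    (avg_mem e ⟨hφ.trans h, hψ⟩ y).2

lemma avg_le_spread (h : φ ∈ Icc (0 : G → ℝ) 1) : avg e φ ≤ spread e φ := fun y =>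
  le_fission _ (avg_mem e h y)

lemma spread_le_mean_mul_avg (h : φ ∈ Icc (0 : G → ℝ) 1) (y : G) :
    spread e φ y ≤ mean (e y).2 * avg e φ y :=
  fission_le_mean_mul _ (avg_mem e h y)

lemma mul_spread_le (hr : r ∈ Icc (0 : ℝ) 1) (h : φ ∈ Icc (0 : G → ℝ) 1) :
    r • spread e φ ≤ spread e (r • φ) := fun y => by
  simp only [spread, avg_smul]
  exact mul_fission_le _ hr (avg_mem e h y)

lemma tendsto_spread {φ : ℕ → G → ℝ} {ψ : G → ℝ} (hφ : ∀ n, φ n ∈ Icc (0 : G → ℝ) 1)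
    (h : ∀ y, Tendsto (fun n => φ n y) atTop (𝓝 (ψ y))) (y : G) :
    Tendsto (fun n => spread e (φ n) y) atTop (𝓝 (spread e ψ y)) :=
  tendsto_fission _ (fun n => avg_mem e (hφ n) y) (tendsto_avg e h y)

lemma iterate_spread_mem (h : φ ∈ Icc (0 : G → ℝ) 1) (n : ℕ) :
    (spread e)^[n] φ ∈ Icc (0 : G → ℝ) 1 := by
  induction n with
  | zero => exact h
  | succ n ih => rw [Function.iterate_succ_apply']; exact spread_mem e ih

lemma iterate_spread_mono (hφ : 0 ≤ φ) (h : φ ≤ ψ) (hψ : ψ ≤ 1) (n : ℕ) :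
    (spread e)^[n] φ ≤ (spread e)^[n] ψ := by
  induction n with
  | zero => exact h
  | succ n ih =>
    simp only [Function.iterate_succ_apply']
    exact spread_mono e (iterate_spread_mem e ⟨hφ, h.trans hψ⟩ n).1 ih
      (iterate_spread_mem e ⟨hφ.trans h, hψ⟩ n).2

end Operators

/-! ### Irreducibility -/

/-- A set of sites that is closed under the steps in a generating set is everything. -/
lemma forall_of_step {S' : Finset G} (hgen : Submonoid.closure (S' : Set G) = ⊤) {p : G → Prop}
    (hp : ∀ y, p y → ∀ s ∈ S', p (y * s)) {y : G} (hy : p y) (z : G) : p z := by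
  have key : ∀ g ∈ Submonoid.closure (S' : Set G), ∀ y, p y → p (y * g) := by
    intro g hg
    induction hg using Submonoid.closure_induction with
    | mem s hs => exact fun y hy => hp y hy s hs
    | one => simp
    | mul a b _ _ ha hb => exact fun y hy => by rw [← mul_assoc]; exact hb _ (ha _ hy)
  have := key (y⁻¹ * z) (by simp [hgen]) y hy
  rwa [mul_inv_cancel_left] at this

/-- A Harnack inequality for nonnegative superharmonic functions, uniform in the environment. -/
lemma exists_harnack {S' : Finset G} (hS' : S' ⊆ S)
    (hgen : Submonoid.closure (S' : Set G) = ⊤) {γ : ℝ} (hγ : 0 < γ) (g : G) :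
    ∃ c : ℝ, 0 < c ∧ ∀ e : Env S, Elliptic γ S' e → ∀ φ : G → ℝ, 0 ≤ φ → avg e φ ≤ φ →
      ∀ z, c * φ (z * g) ≤ φ z := by
  have hg : g ∈ Submonoid.closure (S' : Set G) := by simp [hgen]
  induction hg using Submonoid.closure_induction with
  | mem s hs =>
    refine ⟨γ, hγ, fun e he φ h0 hφ z => ?_⟩
    exact (mul_le_mul_of_nonneg_right (he z ⟨s, hS' hs⟩ hs).le (h0 _)).trans
      ((step_mul_le_avg e h0 z ⟨s, hS' hs⟩).trans (hφ z))
  | one => exact ⟨1, one_pos, by simp⟩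
  | mul a b _ _ ha hb =>
    obtain ⟨c, hc, h1⟩ := ha
    obtain ⟨d, hd, h2⟩ := hb
    refine ⟨c * d, mul_pos hc hd, fun e he φ h0 hφ z => ?_⟩
    have := mul_le_mul_of_nonneg_left (h2 e he φ h0 hφ (z * a)) hc.le
    rw [← mul_assoc z, mul_assoc c]
    exact this.trans (h1 e he φ h0 hφ z)

/-! ### Hitting a site and visiting it infinitely often -/

section Freeze

open Classical in
/-- The value at the starting point `y` of the branching random walk in which particles are frozen
when they reach `x`, and each frozen particle is a success with probability `θ`: this is
the probability of a success among the particles frozen up to time `n`. -/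
noncomputable def freeze (e : Env S) (x : G) (θ : ℝ) : ℕ → G → ℝ
  | 0, y => if y = x then θ else 0
  | n + 1, y => if y = x then θ else spread e (freeze e x θ n) y

/-- The limit of `freeze` for an infinite time horizon. -/
noncomputable def freezeLim (e : Env S) (x : G) (θ : ℝ) (y : G) : ℝ := ⨆ n, freeze e x θ n y

/-- For particles started at `y`, the probability that `x` is visited at some time. -/
noncomputable def hit (e : Env S) (x : G) : G → ℝ := freezeLim e x 1

/-- For particles started at `y`, the probability that `x` is visited infinitely often, as the
limit of the probabilities `(spread e)^[n] (hit e x) y` of visits to `x` at a time `≥ n`. -/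
noncomputable def infVisit (e : Env S) (x y : G) : ℝ := ⨅ n, (spread e)^[n] (hit e x) y

variable (e : Env S) {x y : G} {θ r : ℝ} {φ : G → ℝ}

@[simp] lemma freeze_self (n : ℕ) : freeze e x θ n x = θ := by cases n <;> simp [freeze]

lemma freeze_zero_of_ne (h : y ≠ x) : freeze e x θ 0 y = 0 := by simp [freeze, h]

lemma freeze_succ_of_ne (h : y ≠ x) (n : ℕ) :
    freeze e x θ (n + 1) y = spread e (freeze e x θ n) y := by simp [freeze, h]

lemma freeze_mem (hθ : θ ∈ Icc (0 : ℝ) 1) (n : ℕ) : freeze e x θ n ∈ Icc (0 : G → ℝ) 1 := by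
  induction n with
  | zero =>
    constructor <;> intro y <;> by_cases h : y = x
    all_goals simp [freeze, h, hθ.1, hθ.2]
  | succ n ih =>
    have := spread_mem e ih
    constructor <;> intro y <;> by_cases h : y = x
    · simp [h, hθ.1]
    · rw [freeze_succ_of_ne e h]; exact this.1 y
    · simp [h, hθ.2]
    · rw [freeze_succ_of_ne e h]; exact this.2 y

/-- Minimality of `freeze` among the functions that are supersolutions off `x` and are at least `θ`
at `x`. -/
lemma freeze_le_of_supersolution (hφ : φ ∈ Icc (0 : G → ℝ) 1) (h0 : 0 ≤ θ) (hx : θ ≤ φ x)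
    (h : ∀ y, y ≠ x → spread e φ y ≤ φ y) (n : ℕ) : freeze e x θ n ≤ φ := by
  have hθ : θ ∈ Icc (0 : ℝ) 1 := ⟨h0, hx.trans (hφ.2 x)⟩
  induction n with
  | zero =>
    intro y
    by_cases hy : y = x
    · subst hy; simpa using hx
    · rw [freeze_zero_of_ne e hy]; exact hφ.1 y
  | succ n ih =>
    intro y
    by_cases hy : y = x
    · subst hy; simpa using hx
    · rw [freeze_succ_of_ne e hy]
      exact (spread_mono e (freeze_mem e hθ n).1 ih hφ.2 y).trans (h y hy)

lemma freeze_le_succ (hθ : θ ∈ Icc (0 : ℝ) 1) (n : ℕ) :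
    freeze e x θ n ≤ freeze e x θ (n + 1) := by
  induction n with
  | zero =>
    intro y
    by_cases hy : y = x
    · subst hy; simp
    · rw [freeze_zero_of_ne e hy]; exact (freeze_mem e hθ 1).1 y
  | succ n ih =>
    intro y
    by_cases hy : y = x
    · subst hy; simp
    · rw [freeze_succ_of_ne e hy, freeze_succ_of_ne e hy]
      exact spread_mono e (freeze_mem e hθ n).1 ih (freeze_mem e hθ _).2 y

lemma mul_freeze_le (hr : r ∈ Icc (0 : ℝ) 1) (hθ : θ ∈ Icc (0 : ℝ) 1) (n : ℕ) :
    r • freeze e x θ n ≤ freeze e x (r * θ) n := by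
  induction n with
  | zero =>
    intro y
    by_cases hy : y = x
    · subst hy; simp
    · simp [freeze_zero_of_ne e hy]
  | succ n ih =>
    intro y
    by_cases hy : y = x
    · subst hy; simp
    · have h1 := freeze_mem e (x := x) hθ n
      have h2 := mul_spread_le e hr h1 y
      have h3 := spread_mono e (smul_mem hr h1).1 ih
        (freeze_mem e (mul_mem_Icc_one hr hθ) n).2 y
      simp only [Pi.smul_apply, freeze_succ_of_ne e hy] at h2 ⊢
      exact h2.trans h3

lemma bddAbove_freeze (hθ : θ ∈ Icc (0 : ℝ) 1) (y : G) :
    BddAbove (range fun n => freeze e x θ n y) :=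
  ⟨1, by rintro _ ⟨n, rfl⟩; exact (freeze_mem e hθ n).2 y⟩

lemma tendsto_freeze (hθ : θ ∈ Icc (0 : ℝ) 1) (y : G) :
    Tendsto (fun n => freeze e x θ n y) atTop (𝓝 (freezeLim e x θ y)) :=
  tendsto_atTop_ciSup (monotone_nat_of_le_succ fun n => freeze_le_succ e hθ n y)
    (bddAbove_freeze e hθ y)

lemma freeze_le_freezeLim (hθ : θ ∈ Icc (0 : ℝ) 1) (n : ℕ) : freeze e x θ n ≤ freezeLim e x θ :=
  fun y => le_ciSup (bddAbove_freeze e hθ y) n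

lemma freezeLim_mem (hθ : θ ∈ Icc (0 : ℝ) 1) : freezeLim e x θ ∈ Icc (0 : G → ℝ) 1 :=
  ⟨(freeze_mem e hθ 0).1.trans (freeze_le_freezeLim e hθ 0),
    fun y => ciSup_le fun n => (freeze_mem e hθ n).2 y⟩

@[simp] lemma freezeLim_self : freezeLim e x θ x = θ := by simp [freezeLim]

lemma spread_freezeLim (hθ : θ ∈ Icc (0 : ℝ) 1) (hy : y ≠ x) :
    spread e (freezeLim e x θ) y = freezeLim e x θ y := by
  refine tendsto_nhds_unique (tendsto_spread e (freeze_mem e hθ) (tendsto_freeze e hθ) y)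
    (((tendsto_add_atTop_iff_nat 1).2 (tendsto_freeze e hθ y)).congr fun n => ?_)
  rw [freeze_succ_of_ne e hy]

lemma freezeLim_pos {S' : Finset G} (hS' : S' ⊆ S) (hgen : Submonoid.closure (S' : Set G) = ⊤)
    {γ : ℝ} (hγ : 0 < γ) (he : Elliptic γ S' e) (h0 : 0 < θ) (h1 : θ ≤ 1) (y : G) :
    0 < freezeLim e x θ y := by
  have hmem := freezeLim_mem e (x := x) ⟨h0.le, h1⟩
  by_contra hy
  have hx : ¬ 0 < freezeLim e x θ x := by
    refine forall_of_step hgen (p := fun y => ¬ 0 < freezeLim e x θ y) (fun y hy s hs hys => hy ?_)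
      hy x
    by_cases hyx : y = x
    · subst hyx; simpa using h0
    · rw [← spread_freezeLim e ⟨h0.le, h1⟩ hyx]
      exact lt_of_lt_of_le (mul_pos (hγ.trans (he y ⟨s, hS' hs⟩ hs)) hys)
        ((step_mul_le_avg e hmem.1 y ⟨s, hS' hs⟩).trans (avg_le_spread e hmem y))
  exact hx (by simpa using h0)

lemma one_mem : (1 : ℝ) ∈ Icc (0 : ℝ) 1 := ⟨zero_le_one, le_rfl⟩

lemma hit_mem : hit e x ∈ Icc (0 : G → ℝ) 1 := freezeLim_mem e one_mem

lemma spread_hit_le : spread e (hit e x) ≤ hit e x := fun y => by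
  by_cases hy : y = x
  · subst hy
    exact ((spread_mem e (hit_mem e)).2 y).trans (freezeLim_self e).ge
  · exact (spread_freezeLim e one_mem hy).le

lemma antitone_lateHit (y : G) : Antitone fun n => (spread e)^[n] (hit e x) y := by
  refine antitone_nat_of_succ_le fun n => ?_
  rw [Function.iterate_succ_apply]
  exact iterate_spread_mono e (spread_mem e (hit_mem e)).1 (spread_hit_le e) (hit_mem e).2 n y

lemma bddBelow_lateHit (y : G) : BddBelow (range fun n => (spread e)^[n] (hit e x) y) :=
  ⟨0, by rintro _ ⟨n, rfl⟩; exact (iterate_spread_mem e (hit_mem e) n).1 y⟩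

lemma tendsto_lateHit (y : G) :
    Tendsto (fun n => (spread e)^[n] (hit e x) y) atTop (𝓝 (infVisit e x y)) :=
  tendsto_atTop_ciInf (antitone_lateHit e y) (bddBelow_lateHit e y)

lemma infVisit_le_hit : infVisit e x ≤ hit e x := fun y => ciInf_le (bddBelow_lateHit e y) 0

lemma infVisit_mem : infVisit e x ∈ Icc (0 : G → ℝ) 1 :=
  ⟨fun y => le_ciInf fun n => (iterate_spread_mem e (hit_mem e) n).1 y,
    (infVisit_le_hit e).trans (hit_mem e).2⟩

lemma spread_infVisit : spread e (infVisit e x) = infVisit e x := by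
  funext y
  refine tendsto_nhds_unique (tendsto_spread e (iterate_spread_mem e (hit_mem e))
    (tendsto_lateHit e) y)
    (((tendsto_add_atTop_iff_nat 1).2 (tendsto_lateHit e y)).congr fun n => ?_)
  rw [Function.iterate_succ_apply']

lemma avg_infVisit_le : avg e (infVisit e x) ≤ infVisit e x :=
  (avg_le_spread e (infVisit_mem e)).trans (spread_infVisit e).le

/-- A subsolution below the hitting probability of `x` lies below `infVisit`. -/
lemma le_infVisit (h0 : 0 ≤ φ) (h : φ ≤ spread e φ) (hφ : φ ≤ hit e x) : φ ≤ infVisit e x := by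
  intro y
  refine le_ciInf fun n => ?_
  have : ∀ n, φ ≤ (spread e)^[n] φ := by
    intro n
    induction n with
    | zero => exact le_rfl
    | succ n ih =>
      rw [Function.iterate_succ_apply']
      exact h.trans (spread_mono e h0 ih (iterate_spread_mem e ⟨h0, hφ.trans (hit_mem e).2⟩ n).2)
  exact (this n y).trans (iterate_spread_mono e h0 hφ (hit_mem e).2 n y)

/-- Strong Markov inequality: from `z`, a way to visit `x` infinitely often is to visit `w`
infinitely often and to move on to `x` from there. -/
lemma hit_mul_infVisit_le (w z : G) : hit e x w * infVisit e w z ≤ infVisit e x z := by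
  have hr : hit e x w ∈ Icc (0 : ℝ) 1 := ⟨(hit_mem e).1 w, (hit_mem e).2 w⟩
  have h1 : hit e x w • hit e w ≤ hit e x := by
    intro z
    refine le_of_tendsto' ((tendsto_freeze e one_mem z).const_mul (hit e x w)) fun n => ?_
    refine (mul_freeze_le e hr one_mem n z).trans ?_
    exact freeze_le_of_supersolution e (hit_mem e) (by simpa using hr.1) (by simp)
      (fun y _ => spread_hit_le e y) n z
  refine le_infVisit e (φ := hit e x w • infVisit e w) (smul_mem hr (infVisit_mem e)).1 ?_ ?_ z
  · have := mul_spread_le e hr (infVisit_mem e (x := w))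
    rwa [spread_infVisit] at this
  · exact (smul_le_smul_of_nonneg_left (infVisit_le_hit e) hr.1).trans h1

end Freeze

/-! ### Local survival -/

section Survival

variable (e : Env S) {x y : G} {θ : ℝ} {n : ℕ}

/-- Local survival at `y`: a success at the frozen particles is more likely at the first return to
`y` within `n + 1` steps than the probability `θ` with which each frozen particle is a success.
Then the finitely supported function `freeze e y θ n` is a subsolution, strictly at `y`. -/
def LocallySurvives (e : Env S) (θ : ℝ) (n : ℕ) (y : G) : Prop :=
  θ < spread e (freeze e y θ n) y

lemma LocallySurvives.le_infVisit_self (h : LocallySurvives e θ n y) (h0 : 0 ≤ θ) (h1 : θ ≤ 1) :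
    θ ≤ infVisit e y y := by
  have hθ : θ ∈ Icc (0 : ℝ) 1 := ⟨h0, h1⟩
  refine (freeze_self e n).ge.trans
    (le_infVisit e (φ := freeze e y θ n) (freeze_mem e hθ n).1 (fun z => ?_) ?_ y)
  · by_cases hz : z = y
    · subst hz; rw [freeze_self]; exact h.le
    · rw [← freeze_succ_of_ne e hz]; exact freeze_le_succ e hθ n z
  · exact freeze_le_of_supersolution e (hit_mem e) h0 (by simpa [hit] using h1)
      (fun z _ => spread_hit_le e z) n

/-- If local survival at `y` leads to infinitely many visits to `x` with positive probability,
then it does so with probability at least `θ`, whatever `x` is. Indeed, by concavity the strict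
inequality of local survival is inherited by all success probabilities `t ≤ θ`, and a fixed point
of `spread e` with the value `t` at `y` cannot satisfy it. -/
lemma LocallySurvives.le_infVisit (h : LocallySurvives e θ n y) (h0 : 0 < θ) (h1 : θ ≤ 1)
    (hpos : 0 < infVisit e x y) : θ ≤ infVisit e x y := by
  by_contra! hlt
  set t := infVisit e x y
  have hθ : θ ∈ Icc (0 : ℝ) 1 := ⟨h0.le, h1⟩
  have hr : t / θ ∈ Icc (0 : ℝ) 1 := ⟨by positivity, (div_le_one h0).2 hlt.le⟩
  have hrt : t / θ * θ = t := div_mul_cancel₀ _ h0.ne'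
  have h2 : freeze e y t n ≤ infVisit e x :=
    freeze_le_of_supersolution e (infVisit_mem e) hpos.le le_rfl
      (fun z _ => (congrFun (spread_infVisit e) z).le) n
  have h3 := mul_freeze_le e (x := y) hr hθ n
  rw [hrt] at h3
  have h4 := mul_spread_le e hr (freeze_mem e (x := y) hθ n) y
  have h5 := spread_mono e (smul_mem hr (freeze_mem e hθ n)).1 (h3.trans h2) (infVisit_mem e).2 y
  rw [spread_infVisit] at h5
  have h6 : t / θ * θ < t / θ * spread e (freeze e y θ n) y :=
    mul_lt_mul_of_pos_left h (by positivity)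
  rw [hrt] at h6
  exact absurd (h6.trans_le (h4.trans h5)) (lt_irrefl _)

end Survival

/-! ### Transience without local survival -/

section Transience

open Classical in
/-- The expected number of particles that are frozen at `x` up to time `n`, for particles started
at `y` that are frozen when they reach `x`. -/
noncomputable def green (e : Env S) (x : G) : ℕ → G → ℝ
  | 0, y => if y = x then 1 else 0
  | n + 1, y => if y = x then 1 else mean (e y).2 * avg e (green e x n) y

variable (e : Env S) {x y : G}

@[simp] lemma green_self (n : ℕ) : green e x n x = 1 := by cases n <;> simp [green]

lemma green_succ_of_ne (h : y ≠ x) (n : ℕ) :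
    green e x (n + 1) y = mean (e y).2 * avg e (green e x n) y := by simp [green, h]

lemma green_nonneg (n : ℕ) : 0 ≤ green e x n := by
  induction n with
  | zero => intro y; by_cases h : y = x <;> simp [green, h]
  | succ n ih =>
    intro y
    by_cases h : y = x
    · simp [h]
    · rw [green_succ_of_ne e h]
      exact mul_nonneg (mean_nonneg _)
        ((avg_const e 0 y).ge.trans (avg_mono e (φ := fun _ => 0) ih y))

lemma green_le_succ (n : ℕ) : green e x n ≤ green e x (n + 1) := by
  induction n with
  | zero =>
    intro y
    by_cases h : y = x
    · simp [h]
    · simpa [green, h] using green_nonneg e (x := x) 1 y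
  | succ n ih =>
    intro y
    by_cases h : y = x
    · simp [h]
    · rw [green_succ_of_ne e h, green_succ_of_ne e h]
      exact mul_le_mul_of_nonneg_left (avg_mono e ih y) (mean_nonneg _)

lemma freeze_one_le_green (n : ℕ) : freeze e x 1 n ≤ green e x n := by
  induction n with
  | zero => exact fun y => le_rfl
  | succ n ih =>
    intro y
    by_cases h : y = x
    · simp [h]
    · rw [freeze_succ_of_ne e h, green_succ_of_ne e h]
      exact (spread_le_mean_mul_avg e (freeze_mem e one_mem n) y).trans
        (mul_le_mul_of_nonneg_left (avg_mono e ih y) (mean_nonneg _))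

lemma tendsto_freeze_div_green {θ : ℕ → ℝ} (hθ : ∀ j, θ j ∈ Icc (0 : ℝ) 1) (hθ0 : ∀ j, θ j ≠ 0)
    (hlim : Tendsto θ atTop (𝓝 0)) (n : ℕ) (y : G) :
    Tendsto (fun j => freeze e x (θ j) n y / θ j) atTop (𝓝 (green e x n y)) := by
  induction n generalizing y with
  | zero =>
    by_cases h : y = x
    · simp [h, hθ0]
    · simp [freeze, green, h]
  | succ n ih =>
    by_cases h : y = x
    · simp [h, hθ0]
    · simp only [freeze_succ_of_ne e h, green_succ_of_ne e h]
      refine tendsto_fission_div _ (fun j => avg_mem e (freeze_mem e (hθ j) n) y) hlim hθ0 ?_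
      refine (tendsto_avg e ih y).congr fun j => ?_
      simp only [avg, Finset.sum_div, mul_div_assoc]

lemma one_le_mean (μ : offspringLaws) : 1 ≤ mean μ :=
  fissionRatio_zero μ ▸ fissionRatio_one_le μ ⟨le_rfl, zero_le_one⟩

lemma tendsto_inv_nat : Tendsto (fun j : ℕ => 1 / ((j : ℝ) + 1)) atTop (𝓝 0) :=
  tendsto_one_div_add_atTop_nhds_zero_nat

lemma inv_nat_pos (j : ℕ) : 0 < 1 / ((j : ℝ) + 1) := by positivity

lemma inv_nat_mem (j : ℕ) : 1 / ((j : ℝ) + 1) ∈ Icc (0 : ℝ) 1 :=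
  ⟨(inv_nat_pos j).le,
    (div_le_one (by positivity)).2 (by linarith [(Nat.cast_nonneg j : (0 : ℝ) ≤ j)])⟩

/-- Without local survival at `x`, a particle at `x` has at most one descendant, on average,
among those that return to `x` for the first time. -/
lemma mean_mul_avg_green_le (hx : ∀ j n : ℕ, ¬ LocallySurvives e (1 / ((j : ℝ) + 1)) n x) (n : ℕ) :
    mean (e x).2 * avg e (green e x n) x ≤ 1 := by
  have h : Tendsto (fun j : ℕ => avg e (freeze e x (1 / ((j : ℝ) + 1)) n) x / (1 / ((j : ℝ) + 1)))
      atTop (𝓝 (avg e (green e x n) x)) := by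
    refine (tendsto_avg e (tendsto_freeze_div_green e inv_nat_mem (fun j => (inv_nat_pos j).ne')
      tendsto_inv_nat n) x).congr fun j => ?_
    simp only [avg, Finset.sum_div, mul_div_assoc]
  refine le_of_tendsto' (tendsto_fission_div (e x).2
    (fun j => avg_mem e (freeze_mem e (inv_nat_mem j) n) x) tendsto_inv_nat
    (fun j => (inv_nat_pos j).ne') h) fun j => ?_
  exact (div_le_one (inv_nat_pos j)).2 (not_lt.1 (hx j n))

lemma bddAbove_green {S' : Finset G} (hS' : S' ⊆ S)
    (hgen : Submonoid.closure (S' : Set G) = ⊤) {γ : ℝ} (hγ : 0 < γ) (he : Elliptic γ S' e)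
    (hx : ∀ n, mean (e x).2 * avg e (green e x n) x ≤ 1) (y : G) :
    BddAbove (range fun n => green e x n y) := by
  refine forall_of_step hgen (p := fun y => BddAbove (range fun n => green e x n y)) ?_
    (y := x) ⟨1, by rintro _ ⟨n, rfl⟩; simp⟩ y
  rintro y ⟨C, hC⟩ s hs
  refine ⟨C / γ, ?_⟩
  rintro _ ⟨n, rfl⟩
  have h0 := green_nonneg e (x := x) n
  have h1 := step_mul_le_avg e h0 y ⟨s, hS' hs⟩
  have h2 := mul_le_mul_of_nonneg_right (he y ⟨s, hS' hs⟩ hs).le (h0 (y * s))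
  have h3 : avg e (green e x n) y ≤ mean (e y).2 * avg e (green e x n) y :=
    le_mul_of_one_le_left ((mul_nonneg hγ.le (h0 _)).trans (h2.trans h1)) (one_le_mean _)
  have h4 : mean (e y).2 * avg e (green e x n) y ≤ green e x (n + 1) y := by
    by_cases hy : y = x
    · subst hy; simpa using hx n
    · rw [green_succ_of_ne e hy]
  have h5 : green e x (n + 1) y ≤ C := hC ⟨n + 1, rfl⟩
  exact (le_div_iff₀' hγ).2 (h2.trans (h1.trans (h3.trans (h4.trans h5))))

/-- Infinitely many visits to `x` need one frozen particle whose offspring visits `x` infinitely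
often: since the expected number of frozen particles is finite, they cannot come from infinitely
many frozen particles. -/
lemma infVisit_le_freezeLim (hb : ∀ y, BddAbove (range fun n => green e x n y)) :
    infVisit e x ≤ freezeLim e x (infVisit e x x) := by
  set θ := infVisit e x x with hθdef
  have hθ : θ ∈ Icc (0 : ℝ) 1 := ⟨(infVisit_mem e).1 x, (infVisit_mem e).2 x⟩
  set k : G → ℝ := fun y => ⨆ n, green e x n y with hk
  have hlim : ∀ y, Tendsto (fun n => green e x n y) atTop (𝓝 (k y)) := fun y =>
    tendsto_atTop_ciSup (monotone_nat_of_le_succ fun n => green_le_succ e n y) (hb y)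
  have hkx : k x = 1 := by simp [hk]
  have hkeq : ∀ y, y ≠ x → k y = mean (e y).2 * avg e k y := fun y hy =>
    tendsto_nhds_unique (((tendsto_add_atTop_iff_nat 1).2 (hlim y)).congr
      fun n => green_succ_of_ne e hy n) ((tendsto_avg e hlim y).const_mul _)
  have hhit : infVisit e x ≤ k := (infVisit_le_hit e).trans fun y =>
    ciSup_mono (hb y) fun n => freeze_one_le_green e n y
  -- `k y - green e x n y` is the expected number of particles that are frozen after time `n`
  have main : ∀ n y, infVisit e x y ≤ freeze e x θ n y + (k y - green e x n y) := by
    intro n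
    induction n with
    | zero =>
      intro y
      by_cases hy : y = x
      · subst hy; simp [hkx, hθdef]
      · simpa [freeze, green, hy] using hhit y
    | succ n ih =>
      intro y
      by_cases hy : y = x
      · subst hy; simp [hkx, hθdef]
      · rw [freeze_succ_of_ne e hy, green_succ_of_ne e hy, hkeq y hy, ← mul_sub, ← avg_sub,
          ← congrFun (spread_infVisit e) y]
        have h1 := avg_mem e (infVisit_mem e (x := x)) y
        have h2 := avg_mem e (freeze_mem e hθ n (x := x)) y
        have h3 : avg e (infVisit e x) y - avg e (freeze e x θ n) y
            ≤ avg e (fun z => k z - green e x n z) y := by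
          have := avg_mono e (ψ := fun z => freeze e x θ n z + (k z - green e x n z)) ih y
          rw [avg_add] at this
          linarith
        have h4 : 0 ≤ avg e (fun z => k z - green e x n z) y :=
          (avg_const e 0 y).ge.trans (avg_mono e (φ := fun _ => 0)
            (fun z => sub_nonneg.2 (le_ciSup (hb z) n)) y)
        rcases le_total (avg e (freeze e x θ n) y) (avg e (infVisit e x) y) with h | h
        · have h5 := fission_sub_le (e y).2 h2.1 h h1.2
          have h6 := mul_le_mul_of_nonneg_left h3 (mean_nonneg (e y).2)
          simp only [spread]
          linarith
        · have h5 := fission_mono (e y).2 h1.1 h h2.2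
          have h6 := mul_nonneg (mean_nonneg (e y).2) h4
          simp only [spread]
          linarith
  intro y
  refine ge_of_tendsto' ((tendsto_freeze e hθ y).add ((hlim y).const_sub (k y)) |>.congr
    fun n => rfl) (fun n => main n y) |>.trans ?_
  simp

/-- Without local survival at `x`, the process is transient. Otherwise `freezeLim e x θ` would be
proportional to `θ` for small `θ`, against the strict concavity at a branching site. -/
theorem infVisit_self_eq_zero {S' : Finset G} (hS' : S' ⊆ S)
    (hgen : Submonoid.closure (S' : Set G) = ⊤) {γ : ℝ} (hγ : 0 < γ) (he : Elliptic γ S' e)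
    (hbranch : ∃ z, ∃ k, 2 ≤ k ∧ 0 < (e z).2.1 k)
    (hx : ∀ j n : ℕ, ¬ LocallySurvives e (1 / ((j : ℝ) + 1)) n x) : infVisit e x x = 0 := by
  have hb := bddAbove_green e hS' hgen hγ he (mean_mul_avg_green_le e hx)
  have hA := infVisit_le_freezeLim e hb
  by_contra hne
  set θ₀ := infVisit e x x with hθ₀
  have hmem₀ : θ₀ ∈ Icc (0 : ℝ) 1 := ⟨(infVisit_mem e).1 x, (infVisit_mem e).2 x⟩
  have hpos : 0 < θ₀ := lt_of_le_of_ne hmem₀.1 (Ne.symm hne)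
  obtain ⟨j, hj⟩ := exists_nat_one_div_lt hpos
  set θ : ℝ := 1 / ((j : ℝ) + 1) with hθdef
  have hθ : θ ∈ Icc (0 : ℝ) 1 := inv_nat_mem j
  have hθpos : 0 < θ := inv_nat_pos j
  set r := θ / θ₀ with hrdef
  have hr0 : 0 < r := by positivity
  have hr1 : r < 1 := (div_lt_one hpos).2 hj
  have hr : r ∈ Icc (0 : ℝ) 1 := ⟨hr0.le, hr1.le⟩
  have hrθ : r * θ₀ = θ := div_mul_cancel₀ _ hpos.ne'
  set A := freezeLim e x θ with hAdef
  set A₀ := freezeLim e x θ₀ with hA₀def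
  have hAm : A ∈ Icc (0 : G → ℝ) 1 := freezeLim_mem e hθ
  have hA₀m : A₀ ∈ Icc (0 : G → ℝ) 1 := freezeLim_mem e hmem₀
  have hle : r • A₀ ≤ A := fun y => by
    refine le_of_tendsto_of_tendsto' ((tendsto_freeze e hmem₀ y).const_mul r)
      (tendsto_freeze e hθ y) fun n => ?_
    have := mul_freeze_le e (x := x) hr hmem₀ n y
    rwa [hrθ] at this
  have hSA : spread e A x ≤ θ :=
    le_of_tendsto' (tendsto_spread e (freeze_mem e hθ) (tendsto_freeze e hθ) x)
      fun n => not_lt.1 (hx j n)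
  have hSA₀ : θ₀ ≤ spread e A₀ x := by
    have := spread_mono e (infVisit_mem e).1 hA hA₀m.2 x
    rwa [spread_infVisit] at this
  -- `A` is a supersolution and `A₀` a subsolution, also at `x`
  have hsup : ∀ y, spread e A y ≤ A y := fun y => by
    by_cases hy : y = x
    · subst hy; simpa [hAdef] using hSA
    · exact (spread_freezeLim e hθ hy).le
  have hsub : ∀ y, A₀ y ≤ spread e A₀ y := fun y => by
    by_cases hy : y = x
    · subst hy; simpa [hA₀def] using hSA₀
    · exact (spread_freezeLim e hmem₀ hy).ge
  have hrA : ∀ y, r * avg e A₀ y ≤ avg e A y := fun y => by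
    rw [← avg_smul]; exact avg_mono e hle y
  -- equality of `A` and `r • A₀` at `y` spreads to all sites that can be reached from `y`
  have heq : ∀ y, A y = r * A₀ y → avg e A y = r * avg e A₀ y ∧
      r * fission (e y).2 (avg e A₀ y) = fission (e y).2 (r * avg e A₀ y) := by
    intro y hy
    have h1 := avg_mem e hA₀m y
    have h2 := avg_mem e hAm y
    have h3 := mul_fission_le (e y).2 hr h1
    have h4 := fission_mono (e y).2 (mul_mem_Icc_one hr h1).1 (hrA y) h2.2
    have h5 := mul_le_mul_of_nonneg_left (hsub y) hr0.le
    have h6 := hsup y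
    simp only [spread] at h5 h6
    refine ⟨le_antisymm (not_lt.1 fun hlt => ?_) (hrA y), by linarith⟩
    have h7 := fission_strictMono (e y).2 (mul_mem_Icc_one hr h1).1 hlt h2.2
    linarith
  have hall : ∀ y, A y = r * A₀ y := by
    refine fun y => forall_of_step hgen (p := fun y => A y = r * A₀ y) (fun y hy s hs => ?_)
      (y := x) (by simp [hAdef, hA₀def, hrθ]) y
    have h1 := step_mul_le_avg e (φ := fun z => A z - (r • A₀) z)
      (fun z => sub_nonneg.2 (hle z)) y ⟨s, hS' hs⟩
    rw [avg_sub, avg_smul, (heq y hy).1, sub_self] at h1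
    have h2 := hγ.trans (he y ⟨s, hS' hs⟩ hs)
    have h3 : A (y * s) - r * A₀ (y * s) ≤ 0 := nonpos_of_mul_nonpos_right h1 h2
    exact le_antisymm (by linarith) (hle (y * s))
  obtain ⟨z, k, hk, hz⟩ := hbranch
  have h1 := avg_mem e hA₀m z
  have h2 : 0 < avg e A₀ z := by
    refine lt_of_le_of_ne h1.1 fun h0 => ?_
    have h3 := freezeLim_pos e hS' hgen hγ he (x := x) hpos hmem₀.2 z
    have h4 := hsub z
    rw [spread, ← h0, fission_zero] at h4
    exact absurd (h3.trans_le h4) (lt_irrefl _)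
  exact (mul_fission_lt (e z).2 hk hz hr0 hr1 h2 h1.2).ne (heq z (hall z)).2

end Transience

/-! ### Strong recurrence from a maximum principle -/

/-- A maximum principle for bounded subharmonic functions, relative to a set `H` of sites. It
expresses that the random walk in the environment `e` visits `H` almost surely, from any site. -/
def MaxPrinciple (e : Env S) (H : Set G) : Prop :=
  ∀ w : G → ℝ, w ≤ 1 → w ≤ avg e w → (∀ y ∈ H, w y ≤ 0) → w ≤ 0

/-- The sites `c * b`, where `c` is a site with the property `p` and `b ∈ B`. -/
def cells (p : G → Prop) (B : Finset G) : Set G := {y | ∃ c, p c ∧ ∃ b ∈ B, y = c * b}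

lemma MaxPrinciple.nonempty {e : Env S} {H : Set G} (h : MaxPrinciple e H) : H.Nonempty := by
  by_contra hH
  rw [not_nonempty_iff_eq_empty] at hH
  have := h 1 le_rfl (fun y => (avg_const e 1 y).ge) (by simp [hH]) (1 : G)
  norm_num at this

lemma exists_harnack_finset {S' : Finset G} (hS' : S' ⊆ S)
    (hgen : Submonoid.closure (S' : Set G) = ⊤) {γ : ℝ} (hγ : 0 < γ) (B : Finset G) :
    ∃ c : ℝ, 0 < c ∧ ∀ e : Env S, Elliptic γ S' e → ∀ φ : G → ℝ, 0 ≤ φ → avg e φ ≤ φ →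
      ∀ z, ∀ b ∈ B, c * φ z ≤ φ (z * b) := by
  classical
  induction B using Finset.induction with
  | empty => exact ⟨1, one_pos, by simp⟩
  | insert b B _ ih =>
    obtain ⟨c, hc, h⟩ := ih
    obtain ⟨d, hd, h'⟩ := exists_harnack hS' hgen hγ b⁻¹
    refine ⟨min c d, lt_min hc hd, fun e he φ h0 hφ z a ha => ?_⟩
    rcases Finset.mem_insert.1 ha with rfl | ha
    · have := h' e he φ h0 hφ (z * a)
      rw [mul_inv_cancel_right] at this
      exact (mul_le_mul_of_nonneg_right (min_le_right _ _) (h0 z)).trans this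
    · exact (mul_le_mul_of_nonneg_right (min_le_left _ _) (h0 z)).trans (h e he φ h0 hφ z a ha)

/-- Strong recurrence. The walk along a line of descent meets places of local survival, so the
probability `infVisit e x` is bounded below by a constant. It also meets branching sites, where the
defect `1 - infVisit e x` drops by a fixed factor, and so its supremum is `0`. -/
theorem infVisit_eq_one {S' : Finset G} (hS' : S' ⊆ S)
    (hgen : Submonoid.closure (S' : Set G) = ⊤) {γ : ℝ} (hγ : 0 < γ) {e : Env S}
    (he : Elliptic γ S' e) {θ : ℝ} (hθ0 : 0 < θ) (hθ1 : θ ≤ 1) {n : ℕ} {B : Finset G}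
    (hloc : MaxPrinciple e (cells (LocallySurvives e θ n) B))
    {k : ℕ} (hk : 2 ≤ k) {η : ℝ} (hη : 0 < η)
    (hbranch : MaxPrinciple e (cells (fun c => η < (e c).2.1 k) {1})) (x y : G) :
    infVisit e x y = 1 := by
  obtain ⟨c, hc, hharnack⟩ := exists_harnack_finset hS' hgen hγ B
  have hm := infVisit_mem e (x := x)
  set δ := min (c * θ) 1 with hδ
  have hδ0 : 0 < δ := lt_min (by positivity) one_pos
  have hlow : ∀ y, δ ≤ infVisit e x y := by
    intro y
    have := hloc (fun z => δ - infVisit e x z) (fun z => ?_) (fun z => ?_) ?_ y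
    · simpa using this
    · exact (sub_le_self _ (hm.1 z)).trans (min_le_right _ _)
    · rw [avg_sub, avg_const]
      exact sub_le_sub_left (avg_infVisit_le e z) _
    · rintro z ⟨a, ha, b, hb, rfl⟩
      have h1 : 0 < infVisit e x a :=
        lt_of_lt_of_le (mul_pos (freezeLim_pos e hS' hgen hγ he one_pos le_rfl a)
          (hθ0.trans_le (ha.le_infVisit_self e hθ0.le hθ1))) (hit_mul_infVisit_le e a a)
      have h2 := ha.le_infVisit e hθ0 hθ1 h1
      have h3 := hharnack e he _ hm.1 (avg_infVisit_le e) a b hb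
      have h4 : c * θ ≤ c * infVisit e x a := mul_le_mul_of_nonneg_left h2 hc.le
      exact sub_nonpos.2 ((min_le_left _ _).trans (h4.trans h3))
  set β := ⨆ y, (1 - infVisit e x y) with hβ
  have hbdd : BddAbove (range fun y => 1 - infVisit e x y) :=
    ⟨1, by rintro _ ⟨z, rfl⟩; exact sub_le_self _ (hm.1 z)⟩
  have hle : ∀ z, 1 - infVisit e x z ≤ β := fun z => le_ciSup hbdd z
  have hβ1 : β ≤ 1 - δ := ciSup_le fun z => sub_le_sub_left (hlow z) _
  have hβ0 : 0 ≤ β := (sub_nonneg.2 (hm.2 1)).trans (hle 1)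
  rcases hβ0.eq_or_lt with h0 | hpos
  · exact le_antisymm (hm.2 y) (by linarith [hle y])
  exfalso
  set σ := β - η * (β * (1 - β)) with hσ
  have hση : 0 < η * (β * (1 - β)) := mul_pos hη (mul_pos hpos (by linarith))
  have hsite : ∀ z, η < (e z).2.1 k → 1 - infVisit e x z ≤ σ := by
    intro z hz
    have h1 : 1 - β ≤ avg e (infVisit e x) z := by
      rw [← avg_const e (1 - β) z]
      exact avg_mono e (fun z => by linarith [hle z]) z
    have h2 := fission_mono (e z).2 (by linarith) h1 (avg_mem e hm z).2
    have h3 := add_le_fission (e z).2 (t := 1 - β) hk ⟨by linarith, by linarith⟩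
    have h4 := congrFun (spread_infVisit e (x := x)) z
    rw [spread] at h4
    have h5 : η * ((1 - β) * (1 - (1 - β))) ≤ (e z).2.1 k * ((1 - β) * (1 - (1 - β))) :=
      mul_le_mul_of_nonneg_right hz.le (mul_nonneg (by linarith) (by linarith))
    have h6 : η * ((1 - β) * (1 - (1 - β))) = η * (β * (1 - β)) := by ring
    rw [hσ]; linarith
  obtain ⟨_, a, ha, -⟩ := hbranch.nonempty
  have hσ0 : 0 ≤ σ := (sub_nonneg.2 (hm.2 a)).trans (hsite a ha)
  have hall : ∀ z, 1 - infVisit e x z ≤ σ := by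
    intro z
    have := hbranch (fun z => 1 - infVisit e x z - σ) (fun z => ?_) (fun z => ?_) ?_ z
    · simpa using this
    · have := hm.1 z
      simp only [Pi.zero_apply, Pi.one_apply] at this ⊢
      linarith
    · rw [avg_sub, avg_sub, avg_const, avg_const]
      linarith [avg_infVisit_le e (x := x) z]
    · rintro z ⟨b, hb, d, hd, rfl⟩
      rw [Finset.mem_singleton.1 hd, mul_one]
      linarith [hsite b hb]
  have : β ≤ σ := ciSup_le hall
  linarith

/-! ### Exploration of the environment by the random walk -/

section Explore

open Classical in
/-- The translate `c * B` of a finite set `B`. -/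
noncomputable def cell (B : Finset G) (c : G) : Finset G := B.image (c * ·)

open Classical in
/-- The cell with centre `c` contains `y` and does not meet the explored set `U`. -/
def IsFresh (B U : Finset G) (y c : G) : Prop := y ∈ cell B c ∧ Disjoint (cell B c) U

lemma mem_cell {B : Finset G} {c y : G} : y ∈ cell B c ↔ ∃ b ∈ B, c * b = y := by
  simp only [cell, Finset.mem_image]

open Classical in
/-- The explored set after a test of the cell with centre `c`. -/
noncomputable def enlarge (B U : Finset G) (c : G) : Finset G := U ∪ cell B c

lemma subset_enlarge (B U : Finset G) (c : G) : U ⊆ enlarge B U c := by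
  classical
  exact fun z hz => by simp [enlarge, hz]

lemma cell_subset_enlarge (B U : Finset G) (c : G) : cell B c ⊆ enlarge B U c := by
  classical
  exact fun z hz => by simp [enlarge, hz]

open Classical in
/-- A random walk in the environment `e` starts at `y`. When it enters a cell that does not meet
the explored set `U`, it tests this cell: if the cell is good, it dies, and if not, the cell is
added to `U`. This is the probability that the walk survives `k` tests within `n` steps.

At sites outside all fresh cells `U` is not changed. The environment of such a site influences the
walk, but it is independent of the tests in the future, since the site belongs to no fresh cell. -/
noncomputable def explore (Good : G → Set (Env S)) (B : Finset G) (e : Env S) :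
    ℕ → ℕ → Finset G → G → ℝ
  | _, 0, _, _ => 1
  | 0, _ + 1, _, _ => 0
  | n + 1, k + 1, U, y =>
    if h : ∃ c, IsFresh B U y c then
      if e ∈ Good h.choose then 0
      else avg e (explore Good B e n k (enlarge B U h.choose)) y
    else avg e (explore Good B e n (k + 1) U) y

/-- The limit of `explore` for an infinite time horizon. -/
noncomputable def exploreLim (Good : G → Set (Env S)) (B : Finset G) (e : Env S) (k : ℕ)
    (U : Finset G) (y : G) : ℝ := ⨆ n, explore Good B e n k U y

variable (Good : G → Set (Env S)) (B : Finset G) (e : Env S)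

@[simp] lemma explore_zero_right (n : ℕ) (U : Finset G) (y : G) :
    explore Good B e n 0 U y = 1 := by cases n <;> simp [explore]

lemma explore_mem (n k : ℕ) (U : Finset G) : explore Good B e n k U ∈ Icc (0 : G → ℝ) 1 := by
  induction n generalizing k U with
  | zero => cases k <;> constructor <;> intro y <;> simp [explore]
  | succ n ih =>
    rcases k with _ | k
    · constructor <;> intro y <;> simp
    · constructor <;> intro y <;> rw [explore] <;> split_ifs
      · exact le_rfl
      · exact (avg_mem e (ih _ _) y).1
      · exact (avg_mem e (ih _ _) y).1
      · exact zero_le_one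
      · exact (avg_mem e (ih _ _) y).2
      · exact (avg_mem e (ih _ _) y).2

lemma explore_le_succ (n k : ℕ) (U : Finset G) :
    explore Good B e n k U ≤ explore Good B e (n + 1) k U := by
  induction n generalizing k U with
  | zero =>
    intro y
    rcases k with _ | k
    · simp
    · rw [explore]; exact (explore_mem Good B e _ _ U).1 y
  | succ n ih =>
    intro y
    rcases k with _ | k
    · simp
    · rw [explore, explore]
      split_ifs
      · exact le_rfl
      · exact avg_mono e (ih _ _) y
      · exact avg_mono e (ih _ _) y

lemma bddAbove_explore (k : ℕ) (U : Finset G) (y : G) :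
    BddAbove (range fun n => explore Good B e n k U y) :=
  ⟨1, by rintro _ ⟨n, rfl⟩; exact (explore_mem Good B e n k U).2 y⟩

lemma tendsto_explore (k : ℕ) (U : Finset G) (y : G) :
    Tendsto (fun n => explore Good B e n k U y) atTop (𝓝 (exploreLim Good B e k U y)) :=
  tendsto_atTop_ciSup (monotone_nat_of_le_succ fun n => explore_le_succ Good B e n k U y)
    (bddAbove_explore Good B e k U y)

lemma exploreLim_nonneg (k : ℕ) (U : Finset G) (y : G) : 0 ≤ exploreLim Good B e k U y :=
  ge_of_tendsto' (tendsto_explore Good B e k U y) fun n => (explore_mem Good B e n k U).1 y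

lemma exploreLim_of_fresh {k : ℕ} {U : Finset G} {y : G} (h : ∃ c, IsFresh B U y c)
    (hgood : e ∉ Good h.choose) : exploreLim Good B e (k + 1) U y =
      avg e (exploreLim Good B e k (enlarge B U h.choose)) y := by
  refine tendsto_nhds_unique
    ((tendsto_add_atTop_iff_nat 1).2 (tendsto_explore Good B e (k + 1) U y))
    ((tendsto_avg e (tendsto_explore Good B e k _) y).congr fun n => ?_)
  rw [explore, dif_pos h, if_neg hgood]

lemma exploreLim_of_not_fresh {k : ℕ} {U : Finset G} {y : G} (h : ¬ ∃ c, IsFresh B U y c) :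
    exploreLim Good B e (k + 1) U y = avg e (exploreLim Good B e (k + 1) U) y := by
  refine tendsto_nhds_unique
    ((tendsto_add_atTop_iff_nat 1).2 (tendsto_explore Good B e (k + 1) U y))
    ((tendsto_avg e (tendsto_explore Good B e (k + 1) U) y).congr fun n => ?_)
  rw [explore, dif_neg h]

variable {e} in
/-- The maximum principle on a finite set of sites: an irreducible random walk on an infinite set
leaves each finite set. -/
lemma nonpos_of_subharmonic_on_finite [Infinite G] {S' : Finset G} (hS' : S' ⊆ S)
    (hgen : Submonoid.closure (S' : Set G) = ⊤) {γ : ℝ} (hγ : 0 < γ) (he : Elliptic γ S' e)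
    {N : Set G} (hN : N.Finite) {φ : G → ℝ} (hout : ∀ y, y ∉ N → φ y ≤ 0)
    (hin : ∀ y ∈ N, φ y ≤ avg e φ y) : φ ≤ 0 := by
  intro y₀
  by_contra! h
  simp only [Pi.zero_apply] at h
  have hy₀ : y₀ ∈ N := by_contra fun hy => absurd (hout y₀ hy) (not_le.2 h)
  obtain ⟨a, ha, hmax⟩ := hN.exists_maximalFor φ N ⟨y₀, hy₀⟩
  have hle : ∀ y ∈ N, φ y ≤ φ a := fun y hy => by
    rcases le_total (φ y) (φ a) with h | h
    · exact h
    · exact hmax hy h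
  have ha0 : 0 < φ a := h.trans_le (hle y₀ hy₀)
  have hle' : ∀ y, φ y ≤ φ a := fun y => by
    by_cases hy : y ∈ N
    · exact hle y hy
    · exact (hout y hy).trans ha0.le
  have hall : ∀ y, φ y = φ a := by
    refine fun y => forall_of_step hgen (p := fun y => φ y = φ a) (fun y hy s hs => ?_) (y := a)
      rfl y
    have hyN : y ∈ N := by_contra fun h => absurd (hout y h) (not_le.2 (hy ▸ ha0))
    have h1 := step_mul_le_avg e (φ := fun z => φ a - φ z) (fun z => sub_nonneg.2 (hle' z)) y
      ⟨s, hS' hs⟩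
    rw [avg_sub, avg_const] at h1
    have h2 := hin y hyN
    have h3 := nonpos_of_mul_nonpos_right (h1.trans (by linarith)) (hγ.trans (he y ⟨s, hS' hs⟩ hs))
    exact le_antisymm (hle' _) (by simpa using h3)
  refine Set.infinite_univ (hN.subset fun y _ => by_contra fun hy => ?_)
  exact absurd (hout y hy) (not_le.2 (hall y ▸ ha0))

variable {e} in
/-- A bounded subharmonic function that is nonpositive on the good cells is dominated by the
probability that the walk survives `k` tests. -/
lemma le_exploreLim [Infinite G] {S' : Finset G} (hS' : S' ⊆ S)
    (hgen : Submonoid.closure (S' : Set G) = ⊤) {γ : ℝ} (hγ : 0 < γ) (he : Elliptic γ S' e)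
    (hB : 1 ∈ B) {w : G → ℝ} (hw1 : w ≤ 1) (hw : w ≤ avg e w)
    (hH : ∀ y ∈ cells (fun c => e ∈ Good c) B, w y ≤ 0) (k : ℕ) (U : Finset G) :
    w ≤ exploreLim Good B e k U := by
  induction k generalizing U with
  | zero => exact fun y => (hw1 y).trans (by simp [exploreLim])
  | succ k ih =>
    set N : Set G := {y | ¬ ∃ c, IsFresh B U y c} with hNdef
    have hN : N.Finite := by
      refine ((U.finite_toSet.prod B.finite_toSet).image fun p => p.1 * p.2⁻¹).subset
        fun y hy => ?_
      have h1 : ¬ IsFresh B U y y := fun h => hy ⟨y, h⟩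
      have h2 : ¬ Disjoint (cell B y) U := fun h =>
        h1 ⟨mem_cell.2 ⟨1, hB, mul_one y⟩, h⟩
      obtain ⟨u, hu, huU⟩ := Finset.not_disjoint_iff.1 h2
      obtain ⟨b, hb, rfl⟩ := mem_cell.1 hu
      exact ⟨(y * b, b), ⟨huU, hb⟩, by simp⟩
    have := nonpos_of_subharmonic_on_finite hS' hgen hγ he hN
      (φ := fun y => w y - exploreLim Good B e (k + 1) U y) (fun y hy => ?_) (fun y hy => ?_)
    · exact fun y => sub_nonpos.1 (this y)
    · have hfresh : ∃ c, IsFresh B U y c := not_not.1 hy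
      rw [sub_nonpos]
      by_cases hgood : e ∈ Good hfresh.choose
      · obtain ⟨b, hb, hby⟩ := mem_cell.1 hfresh.choose_spec.1
        exact (hH y ⟨_, hgood, b, hb, hby.symm⟩).trans (exploreLim_nonneg Good B e _ _ _)
      · rw [exploreLim_of_fresh Good B e hfresh hgood]
        exact (hw y).trans (avg_mono e (ih _) y)
    · rw [avg_sub, ← exploreLim_of_not_fresh Good B e hy]
      exact sub_le_sub_right (hw y) _

end Explore

/-! ### Independence in a random environment -/

section Coordinates

variable {ι α : Type*} [MeasurableSpace α]

/-- The `σ`-algebra generated by the coordinates with index in `V`. -/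
abbrev coords (V : Set ι) : MeasurableSpace (ι → α) :=
  ⨆ i ∈ V, MeasurableSpace.comap (fun e : ι → α => e i) inferInstance

lemma coords_le (V : Set ι) : coords (α := α) V ≤ MeasurableSpace.pi :=
  iSup₂_le fun i _ => (measurable_pi_apply i).comap_le

lemma coords_mono {V W : Set ι} (h : V ⊆ W) : coords (α := α) V ≤ coords W :=
  biSup_mono fun _ hi => h hi

lemma measurable_coords {V : Set ι} {i : ι} (hi : i ∈ V) :
    Measurable[coords V] fun e : ι → α => e i :=
  (comap_measurable _).mono (le_iSup₂ (f := fun i (_ : i ∈ V) =>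
    MeasurableSpace.comap (fun e : ι → α => e i) inferInstance) i hi) le_rfl

lemma indep_coords {ν : ι → Measure α} [∀ i, IsProbabilityMeasure (ν i)] {V W : Set ι}
    (h : Disjoint V W) : Indep (coords V) (coords W) (Measure.infinitePi ν) := by
  refine indep_iSup_of_disjoint (fun i => (measurable_pi_apply i).comap_le) ?_ h
  exact iIndepFun_infinitePi (P := ν) (X := fun _ => id) fun _ => measurable_id

end Coordinates

section Random

omit [Group G] in
lemma measurable_step {m : MeasurableSpace (Env S)} {i : G}
    (h : Measurable[m] fun e : Env S => e i) (s : S) : Measurable[m] fun e : Env S => (e i).1.1 s :=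
  ((measurable_pi_apply s).comp (measurable_subtype_coe.comp measurable_fst)).comp h

lemma measurable_avg {m : MeasurableSpace (Env S)} {y : G}
    (h : Measurable[m] fun e : Env S => e y) {φ : Env S → G → ℝ}
    (hφ : ∀ s : S, Measurable[m] fun e => φ e (y * s)) :
    Measurable[m] fun e : Env S => avg e (φ e) y :=
  Finset.measurable_fun_sum _ fun s _ => (measurable_step h s).mul (hφ s)

variable {ν : Measure (stdSimplex ℝ S × offspringLaws)} [IsProbabilityMeasure ν]

variable (Good : G → Set (Env S)) (B : Finset G)

/-- The sites outside all cells that are disjoint from `U`. -/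
def stable (U : Finset G) : Set G := {z | ∀ c, ¬ IsFresh B U z c}

lemma measurable_explore (hGood : ∀ c, MeasurableSet (Good c)) (n k : ℕ) (U : Finset G) (y : G) :
    Measurable fun e : Env S => explore Good B e n k U y := by
  induction n generalizing k U y with
  | zero => cases k <;> simp [explore]
  | succ n ih =>
    rcases k with _ | k
    · simp
    · by_cases h : ∃ c, IsFresh B U y c
      · simp only [explore, dif_pos h]
        exact Measurable.ite (hGood _) measurable_const
          (measurable_avg (measurable_pi_apply y) fun s => ih _ _ _)
      · simp only [explore, dif_neg h]
        exact measurable_avg (measurable_pi_apply y) fun s => ih _ _ _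

lemma lintegral_avg_mul_le {Θ : Measure (Env S)} {V : Set G} {y : G} (hy : y ∈ V)
    {φ : Env S → G → ℝ} (hφ0 : ∀ e, 0 ≤ φ e) (hφ : ∀ z, Measurable fun e => φ e z) {C : ℝ≥0∞}
    (h : ∀ z, ∀ ψ : Env S → ℝ≥0∞, Measurable[coords V] ψ →
      ∫⁻ e, ENNReal.ofReal (φ e z) * ψ e ∂Θ ≤ C * ∫⁻ e, ψ e ∂Θ)
    {ψ : Env S → ℝ≥0∞} (hψ : Measurable[coords V] ψ) :
    ∫⁻ e, ENNReal.ofReal (avg e (φ e) y) * ψ e ∂Θ ≤ C * ∫⁻ e, ψ e ∂Θ := by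
  have hψ' : Measurable ψ := hψ.mono (coords_le V) le_rfl
  have hp : ∀ s : S, Measurable[coords V] fun e : Env S => ENNReal.ofReal ((e y).1.1 s) :=
    fun s => ENNReal.measurable_ofReal.comp (measurable_step (measurable_coords hy) s)
  have hsum : ∀ e : Env S, ∑ s : S, ENNReal.ofReal ((e y).1.1 s) = 1 := fun e => by
    rw [← ENNReal.ofReal_sum_of_nonneg fun s _ => step_nonneg e y s, step_sum, ENNReal.ofReal_one]
  calc ∫⁻ e, ENNReal.ofReal (avg e (φ e) y) * ψ e ∂Θ
      = ∫⁻ e, ∑ s : S, ENNReal.ofReal (φ e (y * s)) * (ENNReal.ofReal ((e y).1.1 s) * ψ e) ∂Θ := by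
        refine lintegral_congr fun e => ?_
        rw [avg, ENNReal.ofReal_sum_of_nonneg fun s _ => mul_nonneg (step_nonneg e y s) (hφ0 e _),
          Finset.sum_mul]
        refine Finset.sum_congr rfl fun s _ => ?_
        rw [ENNReal.ofReal_mul (step_nonneg e y s)]
        ring
    _ = ∑ s : S, ∫⁻ e, ENNReal.ofReal (φ e (y * s)) * (ENNReal.ofReal ((e y).1.1 s) * ψ e) ∂Θ :=
        lintegral_finsetSum _ fun s _ => (ENNReal.measurable_ofReal.comp (hφ _)).mul
          (((hp s).mono (coords_le V) le_rfl).mul hψ')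
    _ ≤ ∑ s : S, C * ∫⁻ e, ENNReal.ofReal ((e y).1.1 s) * ψ e ∂Θ :=
        Finset.sum_le_sum fun s _ => h _ _ ((hp s).mul hψ)
    _ = C * ∫⁻ e, ψ e ∂Θ := by
        rw [← Finset.mul_sum, ← lintegral_finsetSum
          (f := fun (s : S) (e : Env S) => ENNReal.ofReal ((e y).1.1 s) * ψ e) _ fun s _ =>
          ((hp s).mono (coords_le V) le_rfl).mul hψ']
        simp only [← Finset.sum_mul, hsum, one_mul]

/-- The annealed probability to survive `k` tests decays exponentially in `k`, also when it is
weighted with a function of the environment outside the fresh cells. -/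
lemma lintegral_explore_mul_le (hGood : ∀ c, MeasurableSet[coords (cell B c : Set G)] (Good c))
    {q : ℝ≥0∞} (hq : ∀ c, Measure.infinitePi (fun _ : G => ν) (Good c)ᶜ ≤ q)
    (n k : ℕ) (U : Finset G) (y : G) {ψ : Env S → ℝ≥0∞} (hψ : Measurable[coords (stable B U)] ψ) :
    ∫⁻ e, ENNReal.ofReal (explore Good B e n k U y) * ψ e ∂(Measure.infinitePi fun _ : G => ν)
      ≤ q ^ k * ∫⁻ e, ψ e ∂(Measure.infinitePi fun _ : G => ν) := by
  have hGood' : ∀ c, MeasurableSet (Good c) := fun c => coords_le _ _ (hGood c)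
  induction n generalizing k U y ψ with
  | zero => cases k <;> simp [explore]
  | succ n ih =>
    rcases k with _ | k
    · simp
    by_cases h : ∃ c, IsFresh B U y c
    · have hc := h.choose_spec
      set c := h.choose with hcdef
      set U' := enlarge B U c with hU'
      have hdisj : ∀ z, ∀ d, IsFresh B U' z d → IsFresh B U z d := fun z d hd =>
        ⟨hd.1, hd.2.mono_right (subset_enlarge B U c)⟩
      have hsub : stable B U ⊆ stable B U' := fun z hz d hd => hz d (hdisj z d hd)
      have hcell : (cell B c : Set G) ⊆ stable B U' := fun z hz d hd =>
        Finset.disjoint_left.1 hd.2 hd.1 (cell_subset_enlarge B U c hz)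
      have hVW : Disjoint (cell B c : Set G) (stable B U) :=
        Set.disjoint_left.2 fun z hz hz' => hz' c ⟨hz, hc.2⟩
      set χ : Env S → ℝ≥0∞ := (Good c)ᶜ.indicator 1 with hχ
      have hχm : Measurable[coords (cell B c : Set G)] χ :=
        Measurable.indicator (measurable_const (a := (1 : ℝ≥0∞))) (hGood c).compl
      calc ∫⁻ e, ENNReal.ofReal (explore Good B e (n + 1) (k + 1) U y) * ψ e
            ∂(Measure.infinitePi fun _ : G => ν)
          = ∫⁻ e, ENNReal.ofReal (avg e (explore Good B e n k U') y) * (χ e * ψ e)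
            ∂(Measure.infinitePi fun _ : G => ν) := by
            refine lintegral_congr fun e => ?_
            rw [explore, dif_pos h]
            by_cases hg : e ∈ Good c
            · simp [hχ, ← hcdef, hg]
            · rw [if_neg hg]
              simp only [hχ, Set.indicator_of_mem (show e ∈ (Good c)ᶜ from hg), Pi.one_apply,
                one_mul]
              rfl
        _ ≤ q ^ k * ∫⁻ e, χ e * ψ e ∂(Measure.infinitePi fun _ : G => ν) :=
            lintegral_avg_mul_le (V := stable B U') (hcell hc.1)
              (fun e => (explore_mem Good B e n k U').1)
              (fun z => measurable_explore Good B hGood' n k U' z)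
              (fun z ψ hψ => ih k U' z hψ)
              ((hχm.mono (coords_mono hcell) le_rfl).mul (hψ.mono (coords_mono hsub) le_rfl))
        _ = q ^ k * (Measure.infinitePi (fun _ : G => ν) (Good c)ᶜ
              * ∫⁻ e, ψ e ∂(Measure.infinitePi fun _ : G => ν)) := by
            rw [lintegral_mul_eq_lintegral_mul_lintegral_of_independent_measurableSpace
              (coords_le _) (coords_le _) (indep_coords hVW) hχm hψ,
              lintegral_indicator_one (hGood' c).compl]
        _ ≤ q ^ (k + 1) * ∫⁻ e, ψ e ∂(Measure.infinitePi fun _ : G => ν) := by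
            rw [pow_succ, mul_assoc]
            gcongr
            exact hq c
    · simp only [explore, dif_neg h]
      exact lintegral_avg_mul_le (V := stable B U) (fun c hc => h ⟨c, hc⟩)
        (fun e => (explore_mem Good B e n (k + 1) U).1)
        (fun z => measurable_explore Good B hGood' n (k + 1) U z)
        (fun z ψ hψ => ih (k + 1) U z hψ) hψ

/-- In an i.i.d. environment the random walk visits good cells almost surely, if each cell is good
with probability at least `1 - q > 0`. -/
theorem ae_maxPrinciple [Infinite G] [Countable G] {S' : Finset G} (hS' : S' ⊆ S)
    (hgen : Submonoid.closure (S' : Set G) = ⊤) {γ : ℝ} (hγ : 0 < γ)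
    (he : ∀ᵐ e ∂(Measure.infinitePi fun _ : G => ν), Elliptic γ S' e) (hB : 1 ∈ B)
    (hGood : ∀ c, MeasurableSet[coords (cell B c : Set G)] (Good c))
    {q : ℝ≥0∞} (hq1 : q < 1) (hq : ∀ c, Measure.infinitePi (fun _ : G => ν) (Good c)ᶜ ≤ q) :
    ∀ᵐ e ∂(Measure.infinitePi fun _ : G => ν),
      MaxPrinciple e (cells (fun c => e ∈ Good c) B) := by
  have hGood' : ∀ c, MeasurableSet (Good c) := fun c => coords_le _ _ (hGood c)
  have hm : ∀ n k y, Measurable fun e : Env S => ENNReal.ofReal (explore Good B e n k ∅ y) :=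
    fun n k y => ENNReal.measurable_ofReal.comp (measurable_explore Good B hGood' n k ∅ y)
  have hzero : ∀ᵐ e ∂(Measure.infinitePi fun _ : G => ν), ∀ y,
      ⨅ k, ⨆ n, ENNReal.ofReal (explore Good B e n k ∅ y) = 0 := by
    rw [ae_all_iff]
    intro y
    have hmeas : Measurable fun e : Env S =>
        ⨅ k, ⨆ n, ENNReal.ofReal (explore Good B e n k ∅ y) :=
      Measurable.iInf fun k => Measurable.iSup fun n => hm n k y
    refine (lintegral_eq_zero_iff hmeas).1 ?_
    refine le_antisymm (ge_of_tendsto' (ENNReal.tendsto_pow_atTop_nhds_zero_of_lt_one hq1)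
      fun k => ?_) zero_le
    calc ∫⁻ e, ⨅ k, ⨆ n, ENNReal.ofReal (explore Good B e n k ∅ y)
          ∂(Measure.infinitePi fun _ : G => ν)
        ≤ ∫⁻ e, ⨆ n, ENNReal.ofReal (explore Good B e n k ∅ y)
          ∂(Measure.infinitePi fun _ : G => ν) := lintegral_mono fun e => iInf_le _ k
      _ = ⨆ n, ∫⁻ e, ENNReal.ofReal (explore Good B e n k ∅ y)
          ∂(Measure.infinitePi fun _ : G => ν) :=
          lintegral_iSup (fun n => hm n k y) (monotone_nat_of_le_succ fun n e =>
            ENNReal.ofReal_le_ofReal (explore_le_succ Good B e n k ∅ y))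
      _ ≤ q ^ k := iSup_le fun n => by
          simpa using lintegral_explore_mul_le Good B hGood hq n k ∅ y (ψ := 1)
            (@measurable_const _ _ _ (coords (stable B ∅)) 1)
  filter_upwards [he, hzero] with e hell hz w hw1 hw hH y
  refine ENNReal.ofReal_eq_zero.1 (le_antisymm ?_ zero_le)
  rw [← hz y]
  refine le_iInf fun k => (ENNReal.ofReal_le_ofReal
    (le_exploreLim Good B hS' hgen hγ hell hB hw1 hw hH k ∅ y)).trans ?_
  exact le_of_tendsto' (ENNReal.tendsto_ofReal (tendsto_explore Good B e k ∅ y))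
    fun n => le_iSup (fun n => ENNReal.ofReal (explore Good B e n k ∅ y)) n

end Random

/-! ### The branching property -/

section Branching

variable {X : Type*}

lemma measurable_to_pi {Ω ι α : Type*} [MeasurableSpace α] {m : MeasurableSpace Ω} {f : Ω → ι → α}
    (h : ∀ i, Measurable[m] fun ω => f ω i) : Measurable[m] f :=
  measurable_pi_iff.2 h

/-- The input for the descendants of the `i`-th child of the root. -/
def shift (i : ℕ) (Z : Noise X) : Noise X := fun p => Z (p.1 ++ [i], p.2)

lemma pos_append (Z : Noise X) (y : X) (i : ℕ) (v : List ℕ) :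
    pos Z y (v ++ [i]) = pos (shift i Z) (Z ([i], y)).2 v := by
  induction v with
  | nil => simp [pos]
  | cons j v ih => simp [pos, shift, ih]

lemma isBorn_append (Z : Noise X) (y : X) (i : ℕ) (v : List ℕ) :
    IsBorn Z y (v ++ [i]) ↔ i < (Z ([], y)).1 ∧ IsBorn (shift i Z) (Z ([i], y)).2 v := by
  induction v with
  | nil => simp [IsBorn, pos]
  | cons j v ih =>
    simp only [List.cons_append, IsBorn, ih, pos_append, and_assoc]
    rfl

/-- Some particle is at `x` at time `n`, when the root is at `y`. -/
def VisitsAt (Z : Noise X) (x y : X) (n : ℕ) : Prop :=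
  ∃ u : List ℕ, u.length = n ∧ IsBorn Z y u ∧ pos Z y u = x

lemma visitsAt_zero (Z : Noise X) (x y : X) : VisitsAt Z x y 0 ↔ y = x := by
  simp [VisitsAt, IsBorn, pos]

lemma visitsAt_succ (Z : Noise X) (x y : X) (n : ℕ) :
    VisitsAt Z x y (n + 1) ↔
      ∃ i < (Z ([], y)).1, VisitsAt (shift i Z) x (Z ([i], y)).2 n := by
  constructor
  · rintro ⟨u, hu, hb, hp⟩
    obtain ⟨v, i, rfl⟩ : ∃ v i, u = v ++ [i] :=
      ⟨u.dropLast, u.getLast (by rintro rfl; simp at hu),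
        (List.dropLast_append_getLast _).symm⟩
    rw [isBorn_append] at hb
    rw [pos_append] at hp
    exact ⟨i, hb.1, v, by simpa using hu, hb.2, hp⟩
  · rintro ⟨i, hi, v, hv, hb, hp⟩
    exact ⟨v ++ [i], by simp [hv], (isBorn_append ..).2 ⟨hi, hb⟩, (pos_append ..).trans hp⟩

/-- Two inputs that differ at most in the moves of the root, which are never used. -/
def SameTree (Z Z' : Noise X) : Prop :=
  (∀ v ≠ [], ∀ x, Z (v, x) = Z' (v, x)) ∧ ∀ x, (Z ([], x)).1 = (Z' ([], x)).1

lemma SameTree.pos_eq {Z Z' : Noise X} (h : SameTree Z Z') (y : X) (u : List ℕ) :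
    pos Z y u = pos Z' y u := by
  induction u with
  | nil => rfl
  | cons i v ih => simp [pos, ih, h.1 (i :: v) (by simp)]

lemma SameTree.isBorn_iff {Z Z' : Noise X} (h : SameTree Z Z') (y : X) (u : List ℕ) :
    IsBorn Z y u ↔ IsBorn Z' y u := by
  induction u with
  | nil => rfl
  | cons i v ih =>
    have : ∀ x, (Z (v, x)).1 = (Z' (v, x)).1 := fun x => by
      rcases eq_or_ne v [] with rfl | hv
      · exact h.2 x
      · rw [h.1 v hv]
    simp [IsBorn, ih, h.pos_eq, this]

lemma SameTree.visitsAt_iff {Z Z' : Noise X} (h : SameTree Z Z') (x y : X) (n : ℕ) :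
    VisitsAt Z x y n ↔ VisitsAt Z' x y n := by
  simp [VisitsAt, h.pos_eq, h.isBorn_iff]

variable [MeasurableSpace X]

lemma measurable_shift (i : ℕ) :
    Measurable[coords {p : List ℕ × X | ∃ v, p.1 = v ++ [i]}] (shift i : Noise X → Noise X) :=
  measurable_to_pi fun p => measurable_coords ⟨p.1, rfl⟩

variable (P : X → PMF X) (μ : X → PMF ℕ)

instance : IsProbabilityMeasure (noiseLaw P μ) := by unfold noiseLaw; infer_instance

lemma measurePreserving_shift (i : ℕ) :
    MeasurePreserving (shift i) (noiseLaw P μ) (noiseLaw P μ) := by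
  refine ⟨(measurable_shift i).mono (coords_le _) le_rfl, ?_⟩
  exact Measure.map_infinitePi_infinitePi_of_inj
    (P := fun p : List ℕ × X => (μ p.2).toMeasure.prod (P p.2).toMeasure)
    (f := fun p : List ℕ × X => (p.1 ++ [i], p.2)) fun p q h => by
      simp only [Prod.mk.injEq, List.append_left_inj] at h
      exact Prod.ext h.1 h.2

variable [DiscreteMeasurableSpace X] [Countable X]

lemma noiseLaw_eval (p : List ℕ × X) (k : ℕ) (z : X) :
    noiseLaw P μ {Z | Z p = (k, z)} = μ p.2 k * P p.2 z := by
  have h := (measurePreserving_eval_infinitePi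
    (fun p : List ℕ × X => (μ p.2).toMeasure.prod (P p.2).toMeasure) p).measure_preimage
    (measurableSet_singleton (k, z)).nullMeasurableSet
  rw [← Set.singleton_prod_singleton, Measure.prod_prod,
    PMF.toMeasure_apply_singleton _ _ (measurableSet_singleton _),
    PMF.toMeasure_apply_singleton _ _ (measurableSet_singleton _)] at h
  rw [← h, Set.singleton_prod_singleton]
  rfl

omit [DiscreteMeasurableSpace X] in
lemma noiseLaw_eval_fst (p : List ℕ × X) (k : ℕ) :
    noiseLaw P μ {Z | (Z p).1 = k} = μ p.2 k := by
  have h := (measurePreserving_eval_infinitePi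
    (fun p : List ℕ × X => (μ p.2).toMeasure.prod (P p.2).toMeasure) p).measure_preimage
    (measurable_fst (measurableSet_singleton k)).nullMeasurableSet
  rw [← Set.prod_univ, Measure.prod_prod,
    PMF.toMeasure_apply_singleton _ _ (measurableSet_singleton _), measure_univ, mul_one] at h
  rw [← h, Set.prod_univ]
  rfl

/-- The move of a particle is independent of the tree of its descendants, although both are read
from the same input: the descendants do not use the move of the root of their tree. -/
lemma noiseLaw_move_inter {y z : X} {A : Set (Noise X)} (hA : MeasurableSet A)
    (hinv : ∀ Z Z', SameTree Z Z' → (Z ∈ A ↔ Z' ∈ A)) :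
    noiseLaw P μ ({Z | (Z ([], y)).2 = z} ∩ A) = P y z * noiseLaw P μ A := by
  classical
  set r : List ℕ × X := ([], y)
  -- given that the root has `k` children, `A` is an event `R k` of the other coordinates
  set R : ℕ → Set (Noise X) := fun k => {Z | Function.update Z r (k, z) ∈ A} with hR
  have hRm : ∀ k, MeasurableSet[coords {r}ᶜ] (R k) := fun k => by
    have : Measurable[coords {r}ᶜ] fun Z : Noise X => Function.update Z r (k, z) := by
      refine measurable_to_pi fun p => ?_
      by_cases hp : p = r
      · subst hp; simp only [Function.update_self]; exact measurable_const
      · simp only [Function.update_of_ne hp]; exact measurable_coords hp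
    exact this hA
  have hRm' : ∀ k, MeasurableSet (R k) := fun k => coords_le _ _ (hRm k)
  have hsame : ∀ Z : Noise X, SameTree Z (Function.update Z r ((Z r).1, z)) := fun Z => by
    refine ⟨fun v hv x => (Function.update_of_ne (fun h => hv (congrArg Prod.fst h)) _ _).symm,
      fun x => ?_⟩
    by_cases hx : ([], x) = r
    · rw [hx]; simp
    · rw [Function.update_of_ne hx]
  have hAR : ∀ Z : Noise X, Z ∈ A ↔ Z ∈ R (Z r).1 := fun Z => hinv _ _ (hsame Z)
  have hind : Indep (coords {r}) (coords {r}ᶜ) (noiseLaw P μ) :=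
    indep_coords (disjoint_compl_right)
  have hr : Measurable[coords {r}] fun Z : Noise X => Z r := measurable_coords rfl
  have h1 : ∀ k, noiseLaw P μ ({Z | Z r = (k, z)} ∩ R k) = μ y k * P y z * noiseLaw P μ (R k) :=
    fun k => by
      rw [← noiseLaw_eval P μ r k z]
      exact (Indep_iff _ _ _).1 hind _ _ (hr (measurableSet_singleton _)) (hRm k)
  have h2 : ∀ k, noiseLaw P μ ({Z | (Z r).1 = k} ∩ R k) = μ y k * noiseLaw P μ (R k) :=
    fun k => by
      rw [← noiseLaw_eval_fst P μ r k]
      exact (Indep_iff _ _ _).1 hind _ _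
        ((measurable_fst.comp hr) (measurableSet_singleton k)) (hRm k)
  have hrm : Measurable fun Z : Noise X => Z r := measurable_pi_apply r
  have e1 : {Z : Noise X | (Z r).2 = z} ∩ A = ⋃ k, {Z | Z r = (k, z)} ∩ R k := by
    ext Z
    simp only [mem_inter_iff, mem_ofPred_eq, mem_iUnion, Prod.ext_iff]
    constructor
    · rintro ⟨h, hZ⟩; exact ⟨_, ⟨rfl, h⟩, (hAR Z).1 hZ⟩
    · rintro ⟨k, ⟨rfl, h⟩, hZ⟩; exact ⟨h, (hAR Z).2 hZ⟩
  have e2 : A = ⋃ k, {Z : Noise X | (Z r).1 = k} ∩ R k := by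
    ext Z
    simp only [mem_inter_iff, mem_ofPred_eq, mem_iUnion]
    constructor
    · exact fun hZ => ⟨_, rfl, (hAR Z).1 hZ⟩
    · rintro ⟨k, rfl, hZ⟩; exact (hAR Z).2 hZ
  rw [e1, measure_iUnion, tsum_congr h1]
  · conv_rhs => rw [e2]
    rw [measure_iUnion, tsum_congr h2, ← ENNReal.tsum_mul_left]
    · exact tsum_congr fun k => by ring
    · intro k l hkl
      exact Set.disjoint_left.2 fun Z h h' => hkl (h.1.symm.trans h'.1)
    · exact fun k => ((measurable_fst.comp hrm) (measurableSet_singleton k)).inter (hRm' k)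
  · intro k l hkl
    exact Set.disjoint_left.2 fun Z h h' => hkl (congrArg Prod.fst (h.1.symm.trans h'.1))
  · exact fun k => (hrm (measurableSet_singleton (k, z))).inter (hRm' k)

/-- The branching property: the subtrees of the children of the root are independent copies of the
tree, started at the positions of the children. -/
lemma noiseLaw_compl_exists_child {A : X → Set (Noise X)} (hA : ∀ z, MeasurableSet (A z))
    (hinv : ∀ z Z Z', SameTree Z Z' → (Z ∈ A z ↔ Z' ∈ A z)) (y : X) :
    noiseLaw P μ {Z | ∃ i < (Z ([], y)).1, shift i Z ∈ A (Z ([i], y)).2}ᶜ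
      = ∑' k, μ y k * (∑' z, P y z * noiseLaw P μ (A z)ᶜ) ^ k := by
  set r : List ℕ × X := ([], y)
  set E : Set (Noise X) := {Z | Z ∉ A (Z r).2} with hE
  have hrm : Measurable fun Z : Noise X => Z r := measurable_pi_apply r
  have hEz : E = ⋃ z, {Z : Noise X | (Z r).2 = z} ∩ (A z)ᶜ := by
    ext Z
    simp only [hE, mem_ofPred_eq, mem_iUnion, mem_inter_iff, mem_compl_iff]
    exact ⟨fun h => ⟨_, rfl, h⟩, by rintro ⟨z, rfl, h⟩; exact h⟩
  have hzm : ∀ z, MeasurableSet ({Z : Noise X | (Z r).2 = z} ∩ (A z)ᶜ) := fun z =>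
    ((measurable_snd.comp hrm) (measurableSet_singleton z)).inter (hA z).compl
  have hEm : MeasurableSet E := hEz ▸ MeasurableSet.iUnion hzm
  have hPE : noiseLaw P μ E = ∑' z, P y z * noiseLaw P μ (A z)ᶜ := by
    rw [hEz, measure_iUnion _ hzm]
    · exact tsum_congr fun z => noiseLaw_move_inter P μ (hA z).compl
        fun Z Z' h => not_congr (hinv z Z Z' h)
    · intro z w hzw
      exact Set.disjoint_left.2 fun Z h h' => hzw (h.1.symm.trans h'.1)
  set J : ℕ → Set (List ℕ × X) := fun i => {p | ∃ v, p.1 = v ++ [i]} with hJ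
  have hEi : ∀ i, MeasurableSet[coords (J i)] (shift i ⁻¹' E) := fun i => measurable_shift i hEm
  have hPEi : ∀ i, noiseLaw P μ (shift i ⁻¹' E) = noiseLaw P μ E := fun i =>
    (measurePreserving_shift P μ i).measure_preimage hEm.nullMeasurableSet
  -- the number of children of the root and the subtrees of the children are independent
  have key : ∀ (C : Set (Noise X)) (k : ℕ), MeasurableSet[coords {r}] C →
      MeasurableSet[coords ({r} ∪ ⋃ i < k, J i)] (C ∩ ⋂ i < k, shift i ⁻¹' E) ∧
      noiseLaw P μ (C ∩ ⋂ i < k, shift i ⁻¹' E) = noiseLaw P μ C * noiseLaw P μ E ^ k := by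
    intro C k hC
    induction k with
    | zero => exact ⟨by simpa using coords_mono subset_union_left _ hC, by simp⟩
    | succ k ih =>
      have e : C ∩ ⋂ i < k + 1, shift i ⁻¹' E
          = (C ∩ ⋂ i < k, shift i ⁻¹' E) ∩ shift k ⁻¹' E := by
        rw [Set.biInter_lt_succ, Set.inter_assoc]
      have hdisj : Disjoint ({r} ∪ ⋃ i < k, J i) (J k) := by
        rw [Set.disjoint_left]
        rintro p hp ⟨v, hv⟩
        rcases hp with rfl | hp
        · simp [r] at hv
        · simp only [mem_iUnion] at hp
          obtain ⟨i, hi, w, hw⟩ := hp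
          rw [hv] at hw
          have := (List.append_inj' hw rfl).2
          simp at this
          omega
      rw [e]
      constructor
      · refine MeasurableSet.inter (coords_mono ?_ _ ih.1) (coords_mono ?_ _ (hEi k))
        · exact Set.union_subset_union_right _
            (Set.biUnion_subset_biUnion_left fun i hi => Nat.lt_succ_of_lt hi)
        · exact fun p hp => Or.inr (mem_iUnion₂.2 ⟨k, Nat.lt_succ_self k, hp⟩)
      · have hind : Indep (coords ({r} ∪ ⋃ i < k, J i)) (coords (J k)) (noiseLaw P μ) :=
          indep_coords hdisj
        rw [(Indep_iff _ _ _).1 hind _ _ ih.1 (hEi k), ih.2, hPEi, pow_succ, mul_assoc]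
  have hr : Measurable[coords {r}] fun Z : Noise X => Z r := measurable_coords rfl
  have hC : ∀ k, MeasurableSet[coords {r}] {Z : Noise X | (Z r).1 = k} := fun k =>
    (measurable_fst.comp hr) (measurableSet_singleton k)
  have hsplit : {Z | ∃ i < (Z r).1, shift i Z ∈ A (Z ([i], y)).2}ᶜ
      = ⋃ k, {Z : Noise X | (Z r).1 = k} ∩ ⋂ i < k, shift i ⁻¹' E := by
    ext Z
    simp only [mem_compl_iff, mem_ofPred_eq, not_exists, not_and, mem_iUnion, mem_inter_iff,
      mem_iInter, mem_preimage, hE]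
    constructor
    · exact fun h => ⟨_, rfl, h⟩
    · rintro ⟨k, rfl, h⟩; exact h
  rw [hsplit, measure_iUnion]
  · refine tsum_congr fun k => ?_
    rw [(key _ k (hC k)).2, hPE, noiseLaw_eval_fst]
  · intro k l hkl
    exact Set.disjoint_left.2 fun Z h h' => hkl (h.1.symm.trans h'.1)
  · exact fun k => coords_le _ _ (key _ k (hC k)).1

omit [DiscreteMeasurableSpace X] in
lemma measurable_eval_comp [MeasurableSingletonClass X] {p : Noise X → X} (hp : Measurable p)
    (v : List ℕ) : Measurable fun Z : Noise X => Z (v, p Z) := by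
  intro s hs
  have : (fun Z : Noise X => Z (v, p Z)) ⁻¹' s
      = ⋃ w, p ⁻¹' {w} ∩ (fun Z : Noise X => Z (v, w)) ⁻¹' s := by
    ext Z; simp
  rw [this]
  exact MeasurableSet.iUnion fun w =>
    (hp (measurableSet_singleton w)).inter (measurable_pi_apply (v, w) hs)

lemma measurable_pos (y : X) (u : List ℕ) : Measurable fun Z : Noise X => pos Z y u := by
  induction u with
  | nil => exact measurable_const
  | cons i v ih => exact measurable_snd.comp (measurable_eval_comp ih (i :: v))

lemma measurableSet_isBorn (y : X) (u : List ℕ) : MeasurableSet {Z : Noise X | IsBorn Z y u} := by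
  induction u with
  | nil => simp [IsBorn]
  | cons i v ih =>
    exact ih.inter ((measurable_fst.comp (measurable_eval_comp (measurable_pos y v) v))
      (measurableSet_Ioi (a := i)))

lemma measurableSet_visitsAt (x y : X) (n : ℕ) :
    MeasurableSet {Z : Noise X | VisitsAt Z x y n} := by
  have : {Z : Noise X | VisitsAt Z x y n}
      = ⋃ u : List ℕ, ⋃ _ : u.length = n, {Z | IsBorn Z y u} ∩ {Z | pos Z y u = x} := by
    ext Z; simp only [VisitsAt, mem_iUnion, mem_inter_iff, mem_ofPred_eq, exists_prop]
  rw [this]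
  exact MeasurableSet.iUnion fun u => MeasurableSet.iUnion fun _ =>
    (measurableSet_isBorn y u).inter (measurable_pos y u (measurableSet_singleton x))

omit [MeasurableSpace X] [DiscreteMeasurableSpace X] [Countable X] in
lemma finite_isBorn (Z : Noise X) (y : X) (n : ℕ) :
    {u : List ℕ | u.length = n ∧ IsBorn Z y u}.Finite := by
  induction n with
  | zero => exact (Set.finite_singleton []).subset fun u hu => List.length_eq_zero_iff.1 hu.1
  | succ n ih =>
    refine (ih.biUnion fun v _ => (Set.finite_Iio (Z (v, pos Z y v)).1).image (· :: v)).subset ?_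
    rintro (_ | ⟨i, v⟩) ⟨hl, hb⟩
    · simp at hl
    · exact Set.mem_biUnion (x := v) ⟨by simpa using hl, hb.1⟩ ⟨i, hb.2, rfl⟩

omit [MeasurableSpace X] [DiscreteMeasurableSpace X] [Countable X] in
/-- The total number of visits is infinite if and only if there are visits at infinitely many
times, since the number of particles is finite at each time. -/
lemma tsum_numAt_eq_top_iff (Z : Noise X) (x : X) :
    ∑' n : ℕ, ((numAt Z x (n + 1) x : ℕ∞) : ℝ≥0∞) = ∞ ↔ ∀ n, ∃ m ≥ n, VisitsAt Z x x m := by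
  have hfin : ∀ n, numAt Z x n x ≠ ⊤ := fun n => by
    rw [numAt, Set.encard_ne_top_iff]
    exact (finite_isBorn Z x n).subset fun u hu => ⟨hu.1, hu.2.1⟩
  have hzero : ∀ n, numAt Z x n x = 0 ↔ ¬ VisitsAt Z x x n := fun n => by
    rw [numAt, Set.encard_eq_zero, Set.eq_empty_iff_forall_notMem]
    exact not_exists.symm
  constructor
  · intro h
    by_contra! hn
    obtain ⟨n, hn⟩ := hn
    rw [tsum_eq_sum (s := Finset.range n) fun m hm => ?_] at h
    · exact ENNReal.sum_ne_top.2 (fun m _ => by simpa using hfin (m + 1)) h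
    · have : n ≤ m := by simpa using hm
      simpa using (hzero (m + 1)).2 (hn (m + 1) (by omega))
  · intro h
    have hinf : {m : ℕ | 1 ≤ ((numAt Z x (m + 1) x : ℕ∞) : ℝ≥0∞)}.Infinite := by
      rw [Set.infinite_iff_exists_gt]
      intro n
      obtain ⟨m, hm, hv⟩ := h (n + 2)
      refine ⟨m - 1, ?_, by omega⟩
      have h1 : m - 1 + 1 = m := by omega
      have h2 : numAt Z x m x ≠ 0 := fun h0 => (hzero m).1 h0 hv
      simp only [Set.mem_ofPred_eq, h1]
      have h3 := Order.one_le_iff_ne_zero.2 h2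
      exact_mod_cast h3
    by_contra hne
    exact hinf (ENNReal.finite_const_le_of_tsum_ne_top hne one_ne_zero)

end Branching

/-! ### The probabilities of visits in a fixed environment -/

section Quenched

lemma tsum_transition_mul (ω : G → stdSimplex ℝ S) (y : G) (c : G → ℝ≥0∞) :
    ∑' z, transition ω y z * c z = ∑ s : S, ENNReal.ofReal ((ω y).1 s) * c (y * s) := by
  classical
  simp only [transition, PMF.map_apply, tsum_fintype, stepPMF, PMF.ofFintype_apply,
    Finset.sum_mul, ite_mul, zero_mul]
  rw [Summable.tsum_finsetSum fun _ _ => ENNReal.summable]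
  exact Finset.sum_congr rfl fun s _ => tsum_ite_eq (y * (s : G)) _

/-- The law of the input of the branching random walk in the environment `e`. -/
noncomputable abbrev quenchedLaw [MeasurableSpace G] (e : Env S) : Measure (Noise G) :=
  noiseLaw (transition fun y => (e y).1) fun y => offspringPMF (e y).2

variable [MeasurableSpace G] [DiscreteMeasurableSpace G] [Countable G] (e : Env S)

/-- The branching property in terms of the evolution operator. -/
lemma quenchedLaw_exists_child {A : G → Set (Noise G)} (hA : ∀ z, MeasurableSet (A z))
    (hinv : ∀ z Z Z', SameTree Z Z' → (Z ∈ A z ↔ Z' ∈ A z)) {φ : G → ℝ}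
    (hφ : φ ∈ Icc (0 : G → ℝ) 1) (hAφ : ∀ z, quenchedLaw e (A z) = ENNReal.ofReal (φ z)) (y : G) :
    quenchedLaw e {Z | ∃ i < (Z ([], y)).1, shift i Z ∈ A (Z ([i], y)).2}
      = ENNReal.ofReal (spread e φ y) := by
  set T : Set (Noise G) := {Z | ∃ i < (Z ([], y)).1, shift i Z ∈ A (Z ([i], y)).2} with hT
  have hTm : MeasurableSet T := by
    have : T = ⋃ i, ⋃ z, {Z : Noise G | i < (Z ([], y)).1} ∩
        ({Z : Noise G | (Z ([i], y)).2 = z} ∩ shift i ⁻¹' A z) := by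
      ext Z; simp [hT]
    rw [this]
    refine MeasurableSet.iUnion fun i => MeasurableSet.iUnion fun z => ?_
    refine ((measurable_fst.comp (measurable_pi_apply _)) (measurableSet_Ioi (a := i))).inter
      (((measurable_snd.comp (measurable_pi_apply _)) (measurableSet_singleton z)).inter ?_)
    exact (measurePreserving_shift (transition fun y => (e y).1)
      (fun y => offspringPMF (e y).2) i).measurable (hA z)
  have ht := avg_mem e hφ y
  set t := avg e φ y with htdef
  have h1 : ∀ z, quenchedLaw e (A z)ᶜ = ENNReal.ofReal (1 - φ z) := fun z => by
    rw [prob_compl_eq_one_sub (hA z), hAφ, ENNReal.ofReal_sub _ (hφ.1 z), ENNReal.ofReal_one]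
  have h2 : ∑' z, transition (fun y => (e y).1) y z * quenchedLaw e (A z)ᶜ
      = ENNReal.ofReal (1 - t) := by
    have h : 1 - t = avg e (fun z => 1 - φ z) y := by rw [avg_sub, avg_const]
    simp only [h1]
    rw [tsum_transition_mul, h, avg, ENNReal.ofReal_sum_of_nonneg fun s _ =>
      mul_nonneg (step_nonneg e y s)
        (show (0 : ℝ) ≤ 1 - φ (y * s) from sub_nonneg.2 (hφ.2 _))]
    exact Finset.sum_congr rfl fun s _ => (ENNReal.ofReal_mul (step_nonneg e y s)).symm
  have h3 : HasSum (fun k => (e y).2.1 k * (1 - t) ^ k) (1 - fission (e y).2 t) := by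
    have := (e y).2.2.2.2.1.sub (summable_fission (e y).2 ht).hasSum
    exact this.congr_fun fun k => by ring
  have h4 : quenchedLaw e Tᶜ = ENNReal.ofReal (1 - fission (e y).2 t) := by
    rw [hT, noiseLaw_compl_exists_child _ _ hA hinv y, h2, ← h3.tsum_eq,
      ENNReal.ofReal_tsum_of_nonneg (fun k => mul_nonneg ((e y).2.2.1 k)
        (pow_nonneg (by linarith [ht.2]) k)) h3.summable]
    refine tsum_congr fun k => ?_
    rw [ENNReal.ofReal_mul ((e y).2.2.1 k), ENNReal.ofReal_pow (by linarith [ht.2])]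
    rfl
  have h5 := fission_mem (e y).2 ht
  rw [← compl_compl T, prob_compl_eq_one_sub hTm.compl, h4, ← ENNReal.ofReal_one,
    ← ENNReal.ofReal_sub _ (by linarith [h5.2]), sub_sub_cancel]
  rfl

omit [Group G] in
lemma measurableSet_exists_visitsAt (x y : G) (p : ℕ → Prop) :
    MeasurableSet {Z : Noise G | ∃ m, p m ∧ VisitsAt Z x y m} := by
  have : {Z : Noise G | ∃ m, p m ∧ VisitsAt Z x y m}
      = ⋃ m, ⋃ _ : p m, {Z | VisitsAt Z x y m} := by ext Z; simp
  rw [this]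
  exact MeasurableSet.iUnion fun m => MeasurableSet.iUnion fun _ => measurableSet_visitsAt x y m

lemma quenchedLaw_visitsAt_succ {x : G} {p : ℕ → Prop} {φ : G → ℝ}
    (hφ : φ ∈ Icc (0 : G → ℝ) 1)
    (h : ∀ z, quenchedLaw e {Z | ∃ m, p m ∧ VisitsAt Z x z m} = ENNReal.ofReal (φ z)) (y : G) :
    quenchedLaw e {Z | ∃ m, p m ∧ VisitsAt Z x y (m + 1)} = ENNReal.ofReal (spread e φ y) := by
  rw [← quenchedLaw_exists_child e (A := fun z => {Z | ∃ m, p m ∧ VisitsAt Z x z m})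
    (fun z => measurableSet_exists_visitsAt x z p) (fun z Z Z' hZ => ?_) hφ h y]
  · congr 1
    ext Z
    simp only [visitsAt_succ, mem_ofPred_eq]
    constructor
    · rintro ⟨m, hm, i, hi, hv⟩; exact ⟨i, hi, m, hm, hv⟩
    · rintro ⟨i, hi, m, hm, hv⟩; exact ⟨m, hm, i, hi, hv⟩
  · simp only [mem_ofPred_eq, hZ.visitsAt_iff]

lemma quenchedLaw_visitsAt_le (x y : G) (n : ℕ) :
    quenchedLaw e {Z | ∃ m, m ≤ n ∧ VisitsAt Z x y m} = ENNReal.ofReal (freeze e x 1 n y) := by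
  induction n generalizing y with
  | zero =>
    by_cases h : y = x
    · simp [visitsAt_zero, h]
    · simp [visitsAt_zero, h, freeze]
  | succ n ih =>
    by_cases h : y = x
    · have : {Z : Noise G | ∃ m, m ≤ n + 1 ∧ VisitsAt Z x y m} = univ :=
        eq_univ_of_forall fun Z => ⟨0, Nat.zero_le _, (visitsAt_zero Z x y).2 h⟩
      rw [this]
      simp [h]
    · rw [freeze_succ_of_ne e h, ← quenchedLaw_visitsAt_succ e (freeze_mem e one_mem n) ih y]
      congr 1
      ext Z
      constructor
      · rintro ⟨m, hm, hv⟩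
        rcases m with _ | m
        · exact absurd ((visitsAt_zero Z x y).1 hv) h
        · exact ⟨m, by omega, hv⟩
      · rintro ⟨m, hm, hv⟩; exact ⟨m + 1, by omega, hv⟩

lemma quenchedLaw_visitsAt_ge (x y : G) (n : ℕ) :
    quenchedLaw e {Z | ∃ m, n ≤ m ∧ VisitsAt Z x y m}
      = ENNReal.ofReal ((spread e)^[n] (hit e x) y) := by
  induction n generalizing y with
  | zero =>
    have h1 : {Z : Noise G | ∃ m, 0 ≤ m ∧ VisitsAt Z x y m}
        = ⋃ n, {Z : Noise G | ∃ m, m ≤ n ∧ VisitsAt Z x y m} := by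
      ext Z
      simp only [mem_ofPred_eq, mem_iUnion]
      exact ⟨fun ⟨m, _, hv⟩ => ⟨m, m, le_rfl, hv⟩, fun ⟨_, m, _, hv⟩ => ⟨m, m.zero_le, hv⟩⟩
    have h2 : Monotone fun n => {Z : Noise G | ∃ m, m ≤ n ∧ VisitsAt Z x y m} :=
      fun a b hab Z ⟨m, hm, hv⟩ => ⟨m, hm.trans hab, hv⟩
    rw [h1]
    refine tendsto_nhds_unique (tendsto_measure_iUnion_atTop h2)
      ((ENNReal.tendsto_ofReal (tendsto_freeze e one_mem y)).congr fun n => ?_)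
    exact (quenchedLaw_visitsAt_le e x y n).symm
  | succ n ih =>
    rw [Function.iterate_succ_apply',
      ← quenchedLaw_visitsAt_succ e (iterate_spread_mem e (hit_mem e) n) ih y]
    congr 1
    ext Z
    constructor
    · rintro ⟨m, hm, hv⟩
      rcases m with _ | m
      · omega
      · exact ⟨m, by omega, hv⟩
    · rintro ⟨m, hm, hv⟩; exact ⟨m + 1, by omega, hv⟩

/-- The quenched probability of infinitely many visits to the starting point. -/
theorem quenchedReturnProb_eq (x : G) :
    quenchedReturnProb e x = ENNReal.ofReal (infVisit e x x) := by
  have h1 : {Z : Noise G | ∑' n : ℕ, ((numAt Z x (n + 1) x : ℕ∞) : ℝ≥0∞) = ∞}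
      = ⋂ n, {Z : Noise G | ∃ m, n ≤ m ∧ VisitsAt Z x x m} := by
    ext Z
    simp only [tsum_numAt_eq_top_iff, mem_iInter, mem_ofPred_eq, ge_iff_le]
  have h2 : Antitone fun n => {Z : Noise G | ∃ m, n ≤ m ∧ VisitsAt Z x x m} :=
    fun a b hab Z ⟨m, hm, hv⟩ => ⟨m, hab.trans hm, hv⟩
  rw [quenchedReturnProb, returnProb, h1]
  refine tendsto_nhds_unique (tendsto_measure_iInter_atTop
    (fun n => (measurableSet_exists_visitsAt x x _).nullMeasurableSet) h2 ⟨0, measure_ne_top _ _⟩)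
    ((ENNReal.tendsto_ofReal (tendsto_lateHit e x)).congr fun n => ?_)
  exact (quenchedLaw_visitsAt_ge e x x n).symm

end Quenched

/-! ### Local survival as an event of the environment -/

section Events

lemma measurable_fission {Ω : Type*} [MeasurableSpace Ω] {f : Ω → offspringLaws} {t : Ω → ℝ}
    (hf : Measurable f) (ht : Measurable t) : Measurable fun ω => fission (f ω) (t ω) :=
  Measurable.tsum fun k => ((measurable_pi_apply k).comp (measurable_subtype_coe.comp hf)).mul
    ((((measurable_const.sub ht).pow_const k)).const_sub 1)

lemma measurable_spread {m : MeasurableSpace (Env S)} {y : G}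
    (h : Measurable[m] fun e : Env S => e y) {φ : Env S → G → ℝ}
    (hφ : ∀ s : S, Measurable[m] fun e => φ e (y * s)) :
    Measurable[m] fun e : Env S => spread e (φ e) y :=
  measurable_fission (measurable_snd.comp h) (measurable_avg h hφ)

open Classical in
/-- The products of at most `n` elements of `S`. -/
noncomputable def ball (S : Finset G) : ℕ → Finset G
  | 0 => {1}
  | n + 1 => insert 1 (Finset.image₂ (· * ·) S (ball S n))

lemma one_mem_ball (n : ℕ) : 1 ∈ ball S n := by cases n <;> simp [ball]

lemma mem_cell_self {B : Finset G} (hB : 1 ∈ B) (y : G) : y ∈ (cell B y : Set G) :=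
  mem_cell.2 ⟨1, hB, mul_one y⟩

lemma cell_ball_subset (n : ℕ) (y : G) (s : S) :
    (cell (ball S n) (y * s) : Set G) ⊆ cell (ball S (n + 1)) y := by
  classical
  intro z hz
  obtain ⟨b, hb, rfl⟩ := mem_cell.1 (Finset.mem_coe.1 hz)
  refine mem_cell.2 ⟨s * b, ?_, by rw [mul_assoc]⟩
  exact Finset.mem_insert_of_mem (Finset.mem_image₂_of_mem s.2 hb)

lemma measurable_freeze (x : G) (θ : ℝ) (n : ℕ) (y : G) :
    Measurable[coords (cell (ball S n) y : Set G)] fun e : Env S => freeze e x θ n y := by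
  induction n generalizing y with
  | zero => exact measurable_const
  | succ n ih =>
    by_cases h : y = x
    · subst h; simp only [freeze_self]; exact measurable_const
    · simp only [freeze_succ_of_ne _ h]
      exact measurable_spread (measurable_coords (mem_cell_self (one_mem_ball _) y)) fun s =>
        (ih _).mono (coords_mono (cell_ball_subset n y s)) le_rfl

lemma measurableSet_locallySurvives (θ : ℝ) (n : ℕ) (c : G) :
    MeasurableSet[coords (cell (ball S (n + 1)) c : Set G)]
      {e : Env S | LocallySurvives e θ n c} :=
  measurable_spread (measurable_coords (mem_cell_self (one_mem_ball _) c))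
    (fun s => (measurable_freeze c θ n _).mono (coords_mono (cell_ball_subset n c s)) le_rfl)
    (measurableSet_Ioi (a := θ))

/-- The environment seen from the site `c`. -/
def translate (c : G) (e : Env S) : Env S := fun y => e (c * y)

lemma spread_translate (c : G) (e : Env S) (φ : G → ℝ) (y : G) :
    spread (translate c e) (fun z => φ (c * z)) y = spread e φ (c * y) := by
  simp only [spread, avg, translate, mul_assoc]

lemma freeze_translate (c : G) (e : Env S) (x : G) (θ : ℝ) (n : ℕ) (y : G) :
    freeze (translate c e) x θ n y = freeze e (c * x) θ n (c * y) := by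
  induction n generalizing y with
  | zero => by_cases h : y = x <;> simp [freeze, h]
  | succ n ih =>
    have : freeze (translate c e) x θ n = fun z => freeze e (c * x) θ n (c * z) := funext ih
    by_cases h : y = x
    · simp [h]
    · rw [freeze_succ_of_ne _ h, freeze_succ_of_ne _ (by simpa using h), this, spread_translate]

lemma locallySurvives_translate (c : G) (e : Env S) (θ : ℝ) (n : ℕ) :
    LocallySurvives (translate c e) θ n 1 ↔ LocallySurvives e θ n c := by
  have : freeze (translate c e) 1 θ n = fun z => freeze e c θ n (c * z) := by
    funext z; rw [freeze_translate, mul_one]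
  rw [LocallySurvives, LocallySurvives, this, spread_translate, mul_one]

variable (Q : Measure (stdSimplex ℝ S)) [IsProbabilityMeasure Q]
  (Q' : Measure offspringLaws) [IsProbabilityMeasure Q']

instance : IsProbabilityMeasure (envLaw G Q Q') := by unfold envLaw; infer_instance

lemma measurePreserving_translate (c : G) :
    MeasurePreserving (translate c) (envLaw G Q Q') (envLaw G Q Q') := by
  refine ⟨measurable_pi_iff.2 fun y => measurable_pi_apply _, ?_⟩
  exact Measure.map_infinitePi_infinitePi_of_inj (P := fun _ : G => Q.prod Q')
    (f := fun y : G => c * y) (mul_right_injective c)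

lemma envLaw_locallySurvives (θ : ℝ) (n : ℕ) (c : G) :
    envLaw G Q Q' {e | LocallySurvives e θ n c} = envLaw G Q Q' {e | LocallySurvives e θ n 1} := by
  rw [← (measurePreserving_translate Q Q' c).measure_preimage
    (coords_le _ _ (measurableSet_locallySurvives θ n 1)).nullMeasurableSet]
  congr 1
  ext e
  exact (locallySurvives_translate c e θ n).symm

omit [Group G] in
lemma envLaw_offspring {A : Set offspringLaws} (hA : MeasurableSet A) (c : G) :
    envLaw G Q Q' {e | (e c).2 ∈ A} = Q' A := by
  have h := ((measurePreserving_eval_infinitePi (fun _ : G => Q.prod Q') c).measure_preimage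
    (measurable_snd hA).nullMeasurableSet)
  have h' := (measurePreserving_snd (μ := Q) (ν := Q')).measure_preimage hA.nullMeasurableSet
  exact h.trans h'

omit [Group G] in
lemma ae_elliptic [Countable G] {γ : ℝ} {S' : Finset G}
    (hQ : ∀ᵐ p ∂Q, ∀ s : S, (s : G) ∈ S' → γ < p.1 s) :
    ∀ᵐ e ∂(envLaw G Q Q'), Elliptic γ S' e := by
  refine ae_all_iff.2 fun y => ?_
  have h1 := (measurePreserving_fst (μ := Q) (ν := Q')).quasiMeasurePreserving.ae hQ
  exact (measurePreserving_eval_infinitePi (fun _ : G => Q.prod Q') y).quasiMeasurePreserving.ae h1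

omit [IsProbabilityMeasure Q'] in
/-- If `m^* > 1`, then a site branches with positive probability. -/
lemma exists_offspring_pos (hm : 1 < mStar Q') :
    ∃ k, 2 ≤ k ∧ ∃ η > 0, Q' {μ | η < μ.1 k} ≠ 0 := by
  obtain ⟨μ, hμ⟩ := lt_iSup_iff.1 hm
  obtain ⟨hsupp, hμ⟩ := lt_iSup_iff.1 hμ
  have hmean : 1 < mean μ := by simpa using hμ
  obtain ⟨k, hk, hpos⟩ : ∃ k, 2 ≤ k ∧ 0 < μ.1 k := by
    by_contra! h
    have h0 : ∀ k : ℕ, (k : ℝ) * μ.1 k ≤ μ.1 k := fun k => by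
      rcases lt_or_ge k 2 with hk | hk
      · have hk1 : (k : ℝ) ≤ 1 := by exact_mod_cast Nat.lt_succ_iff.1 hk
        exact mul_le_of_le_one_left (μ.2.1 k) hk1
      · have : μ.1 k = 0 := le_antisymm (h k hk) (μ.2.1 k)
        simp [this]
    have := Summable.tsum_le_tsum h0 μ.2.2.2.2 μ.2.2.2.1.summable
    rw [μ.2.2.2.1.tsum_eq] at this
    exact absurd hmean (not_lt.2 this)
  refine ⟨k, hk, μ.1 k / 2, half_pos hpos, ?_⟩
  have hopen : IsOpen {ρ : offspringLaws | μ.1 k / 2 < ρ.1 k} :=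
    isOpen_lt continuous_const ((continuous_apply k).comp continuous_subtype_val)
  exact ((Measure.mem_support_iff_forall μ).1 hsupp _
    (hopen.mem_nhds (show μ.1 k / 2 < μ.1 k by linarith))).ne'

variable {γ : ℝ} {S' : Finset G}

lemma ae_maxPrinciple_branching [Infinite G] [Countable G] (hS' : S' ⊆ S)
    (hgen : Submonoid.closure (S' : Set G) = ⊤) (hγ : 0 < γ)
    (he : ∀ᵐ e ∂(envLaw G Q Q'), Elliptic γ S' e) {k : ℕ} {η : ℝ}
    (hη : Q' {μ | η < μ.1 k} ≠ 0) :
    ∀ᵐ e ∂(envLaw G Q Q'), MaxPrinciple e (cells (fun c => η < (e c).2.1 k) {1}) := by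
  have hA : MeasurableSet {μ : offspringLaws | η < μ.1 k} :=
    ((measurable_pi_apply k).comp measurable_subtype_coe) (measurableSet_Ioi (a := η))
  refine ae_maxPrinciple (fun c => {e : Env S | (e c).2 ∈ {μ : offspringLaws | η < μ.1 k}}) {1}
    hS' hgen hγ he (by simp) (fun c => ?_)
    (q := 1 - Q' {μ | η < μ.1 k}) (ENNReal.sub_lt_self ENNReal.one_ne_top one_ne_zero hη)
    fun c => ?_
  · exact (measurable_snd.comp (measurable_coords (mem_cell_self (by simp) c))) hA
  · have hm : MeasurableSet {e : Env S | (e c).2 ∈ {μ : offspringLaws | η < μ.1 k}} :=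
      (measurable_snd.comp (measurable_pi_apply c)) hA
    rw [← envLaw_offspring Q Q' hA c, ← prob_compl_eq_one_sub hm]
    exact le_rfl

lemma ae_maxPrinciple_locallySurvives [Infinite G] [Countable G] (hS' : S' ⊆ S)
    (hgen : Submonoid.closure (S' : Set G) = ⊤) (hγ : 0 < γ)
    (he : ∀ᵐ e ∂(envLaw G Q Q'), Elliptic γ S' e) {θ : ℝ} {n : ℕ}
    (hpos : envLaw G Q Q' {e | LocallySurvives e θ n 1} ≠ 0) :
    ∀ᵐ e ∂(envLaw G Q Q'), MaxPrinciple e (cells (LocallySurvives e θ n) (ball S (n + 1))) := by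
  refine ae_maxPrinciple (fun c => {e : Env S | LocallySurvives e θ n c}) (ball S (n + 1))
    hS' hgen hγ he (one_mem_ball _) (fun c => measurableSet_locallySurvives θ n c)
    (q := 1 - envLaw G Q Q' {e | LocallySurvives e θ n 1})
    (ENNReal.sub_lt_self ENNReal.one_ne_top one_ne_zero hpos) fun c => ?_
  rw [← envLaw_locallySurvives Q Q' θ n c,
    ← prob_compl_eq_one_sub (coords_le _ _ (measurableSet_locallySurvives θ n c))]
  exact le_rfl

lemma countable_of_closure_finset (hgen : Submonoid.closure (S' : Set G) = ⊤) : Countable G := by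
  refine Function.Surjective.countable (f := fun l : List S' => (l.map Subtype.val).prod)
    fun g => ?_
  obtain ⟨l, hl, rfl⟩ := Submonoid.exists_list_of_mem_closure
    (show g ∈ Submonoid.closure (S' : Set G) by simp [hgen])
  lift l to List S' using hl
  exact ⟨l, rfl⟩

/-- The recurrence-transience dichotomy: the process is strongly recurrent if local survival has
positive probability, and transient otherwise. -/
theorem recurrent_xor_transient [Infinite G] [MeasurableSpace G] [DiscreteMeasurableSpace G]
    (hS' : S' ⊆ S) (hS'gen : Submonoid.closure (S' : Set G) = ⊤) (hγ : 0 < γ)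
    (hQ : ∀ᵐ p ∂Q, ∀ s : S, (s : G) ∈ S' → γ < p.1 s) (hm : 1 < mStar Q') :
    Xor (∀ᵐ e ∂(envLaw G Q Q'), ∀ x : G, quenchedReturnProb e x = 1)
      (∀ᵐ e ∂(envLaw G Q Q'), ∀ x : G, quenchedReturnProb e x = 0) := by
  have hcount := countable_of_closure_finset hS'gen
  have hell := ae_elliptic Q Q' hQ
  obtain ⟨k, hk, η, hη, hηQ⟩ := exists_offspring_pos Q' hm
  have hbranch := ae_maxPrinciple_branching Q Q' hS' hS'gen hγ hell hηQ
  have hexcl : ¬ ((∀ᵐ e ∂(envLaw G Q Q'), ∀ x : G, quenchedReturnProb e x = 1) ∧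
      ∀ᵐ e ∂(envLaw G Q Q'), ∀ x : G, quenchedReturnProb e x = 0) := by
    rintro ⟨h1, h0⟩
    obtain ⟨e, he1, he0⟩ := (h1.and h0).exists
    exact one_ne_zero ((he1 1).symm.trans (he0 1))
  by_cases hloc : ∃ j n : ℕ, envLaw G Q Q' {e | LocallySurvives e (1 / ((j : ℝ) + 1)) n 1} ≠ 0
  · obtain ⟨j, n, hjn⟩ := hloc
    have hrec : ∀ᵐ e ∂(envLaw G Q Q'), ∀ x : G, quenchedReturnProb e x = 1 := by
      filter_upwards [hell, hbranch, ae_maxPrinciple_locallySurvives Q Q' hS' hS'gen hγ hell hjn]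
        with e he hb hl x
      rw [quenchedReturnProb_eq, infVisit_eq_one hS' hS'gen hγ he (inv_nat_pos j)
        (inv_nat_mem j).2 hl hk hη hb, ENNReal.ofReal_one]
    exact Or.inl ⟨hrec, fun h => hexcl ⟨hrec, h⟩⟩
  · push Not at hloc
    have hnone : ∀ᵐ e ∂(envLaw G Q Q'), ∀ (x : G) (j n : ℕ),
        ¬ LocallySurvives e (1 / ((j : ℝ) + 1)) n x := by
      refine ae_all_iff.2 fun x => ae_all_iff.2 fun j => ae_all_iff.2 fun n => ?_
      rw [ae_iff]
      simpa only [not_not, envLaw_locallySurvives] using hloc j n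
    have htrans : ∀ᵐ e ∂(envLaw G Q Q'), ∀ x : G, quenchedReturnProb e x = 0 := by
      filter_upwards [hell, hbranch, hnone] with e he hb hn x
      obtain ⟨_, z, hz, -⟩ := hb.nonempty
      rw [quenchedReturnProb_eq, infVisit_self_eq_zero e hS' hS'gen hγ he
        ⟨z, k, hk, hη.trans hz⟩ (hn x), ENNReal.ofReal_zero]
    exact Or.inr ⟨htrans, fun h => hexcl ⟨h, htrans⟩⟩

end Events

end BRWRE

theorem mainTheorem6 {G : Type*} [Group G] [Infinite G]
    [MeasurableSpace G] [DiscreteMeasurableSpace G]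
    (S : Finset G) (hSsymm : ∀ s ∈ S, s⁻¹ ∈ S) (hSgen : Subgroup.closure (S : Set G) = ⊤)
    (Q : Measure (stdSimplex ℝ S)) [IsProbabilityMeasure Q]
    (Q' : Measure BRWRE.offspringLaws) [IsProbabilityMeasure Q']
    (S' : Finset G) (hS' : S' ⊆ S) (hS'gen : Submonoid.closure (S' : Set G) = ⊤)
    (γ : ℝ) (hγ : 0 < γ) (hQ : ∀ᵐ p ∂Q, ∀ s : S, (s : G) ∈ S' → γ < p.1 s)
    (hm : 1 < BRWRE.mStar Q') :
    Xor
      (∀ᵐ e ∂(BRWRE.envLaw G Q Q'), ∀ x : G, BRWRE.quenchedReturnProb e x = 1)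
      (∀ᵐ e ∂(BRWRE.envLaw G Q Q'), ∀ x : G, BRWRE.quenchedReturnProb e x = 0) :=
  BRWRE.recurrent_xor_transient Q Q' hS' hS'gen hγ hQ hm
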